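/- Let $p\ge 3$ be a prime, let $\mathbb{C}_p$ be the completion of an algebraic closure of $\mathbb{Q}_p$ with $|p|=1/p$, and let $\mathcal{O}_p=\{x\in\mathbb{C}_p:|x|\le 1\}$ and $D_r(0)=\{x\in\mathbb{C}_p:|x|<r\}$. Let $\lambda\in\mathbb{C}_p$ be not a root of unity, with $1/p<|1-\lambda|<1$ (so $|\lambda|=1$), and put $P_\lambda(x)=\lambda x+x^2$. For a power series $f(x)=\lambda x+\sum_{i\ge2}a_ix^i\in\mathcal{O}_p[[x]]$, the linearization disk $\Delta_f$ is the largest disk (open or closed) about the origin on which $f$ is analytically conjugate to $T_\lambda:x\mapsto\lambda x$. That is, $f$ converges on the disk and maps it into itself, and there is a power series $H$ with $H(0)=0$, $H'(0)=1$ that converges on the disk and maps it bijectively, with inverse again given by a convergent power series, onto a disk about the origin on which $H\circ f\circ H^{-1}=T_\lambda$. Put $R(0)=0$ and $R(j)=p^{-1/(p^{j-1}(p-1))}$ for integers $j\ge1$. Let $m\ge1$ be the least integer with $|1-\lambda^m|<1$ (so $m=1$ here), let $s\ge0$ be the integer with $R(s)\le|1-\lambda^m|<R(s+1)$, let $\gamma_0$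 be a root of unity of $p$-power order in $\mathbb{C}_p$ minimizing $|\gamma_0-\lambda^m|$, let $t\ge0$ be the integer with $R(t)\le|\gamma_0-\lambda^m|<R(t+1)$, and put $$\tilde r(\lambda)=R(s+1)^{\frac1m}\,p^{-\frac{s-t}{mp^s}}\,|1-\lambda^m|^{s\frac{p-1}{mp}}\,|\gamma_0-\lambda^m|^{\frac{1}{mp^{s-t}}}.$$ Let $f(x)=\lambda x+\sum_{i\ge2}a_ix^i\in\mathcal{O}_p[[x]]$ with $|a_2|=1$ and $|a_2^2-a_3|=1$. Then $$\Delta_f=\Delta_{P_\lambda}=D_r(0),\qquad r=|1-\lambda|^{-1/p}\,\tilde r(\lambda).$$ In particular the linearization disk of $f$ depends only on $\lambda$. -/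

import Mathlib

open scoped PadicComplex

noncomputable section

/-- The value at `x` of a formal power series over `ℂ_[p]`, to be used only where it converges. -/
def psEval {p : ℕ} [Fact p.Prime] (f : PowerSeries ℂ_[p]) (x : ℂ_[p]) : ℂ_[p] :=
  ∑' n : ℕ, PowerSeries.coeff n f * x ^ n

/-- The power series `f` converges at every point of `D`. -/
def ConvergesOn {p : ℕ} [Fact p.Prime] (f : PowerSeries ℂ_[p]) (D : Set ℂ_[p]) : Prop :=
  ∀ x ∈ D, Summable fun n : ℕ => PowerSeries.coeff n f * x ^ n

/-- `D` is a disk about the origin, open or closed, of positive radius. -/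
def IsDiskAboutZero {p : ℕ} [Fact p.Prime] (D : Set ℂ_[p]) : Prop :=
  ∃ r : ℝ, 0 < r ∧ (D = Metric.ball 0 r ∨ D = Metric.closedBall 0 r)

/-- On the set `D`, the series `f` is analytically conjugate to `T : x ↦ l * x`: `f` converges on
`D` and maps it into itself, and there are a power series `H` (with `H(0) = 0`, `H'(0) = 1`)
converging on `D` and a power series `G` converging on a disk `E` about the origin, which are
mutually inverse bijections between `D` and `E`, such that `H ∘ f ∘ G = T` on `E`. -/
def AnalyticallyConjugateOn {p : ℕ} [Fact p.Prime] (f : PowerSeries ℂ_[p]) (l : ℂ_[p])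
    (D : Set ℂ_[p]) : Prop :=
  ConvergesOn f D ∧ Set.MapsTo (psEval f) D D ∧
  ∃ (H G : PowerSeries ℂ_[p]) (E : Set ℂ_[p]), IsDiskAboutZero E ∧
    PowerSeries.coeff 0 H = 0 ∧ PowerSeries.coeff 1 H = 1 ∧
    ConvergesOn H D ∧ ConvergesOn G E ∧
    Set.MapsTo (psEval H) D E ∧ Set.MapsTo (psEval G) E D ∧
    Set.InvOn (psEval G) (psEval H) D E ∧
    ∀ z ∈ E, psEval H (psEval f (psEval G z)) = l * z

/-- `D` is the linearization disk of `f`: the largest disk about the origin on which `f` is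
analytically conjugate to `x ↦ l * x`, where `l` is the linear coefficient of `f`. (There is at
most one such `D`.) -/
def IsLinearizationDisk {p : ℕ} [Fact p.Prime] (f : PowerSeries ℂ_[p]) (D : Set ℂ_[p]) : Prop :=
  IsGreatest {D' : Set ℂ_[p] | IsDiskAboutZero D' ∧
    AnalyticallyConjugateOn f (PowerSeries.coeff 1 f) D'} D

/-- The class of power series `l x + x² 𝒪_p[[x]]`, where `𝒪_p` is the closed unit disk and the
multiplier `l` has absolute value one and is not a root of unity. -/
def classG {p : ℕ} [Fact p.Prime] (l : ℂ_[p]) : Set (PowerSeries ℂ_[p]) :=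
  {f | (‖l‖ = 1 ∧ ∀ n : ℕ, 1 ≤ n → l ^ n ≠ 1) ∧
    PowerSeries.coeff 0 f = 0 ∧ PowerSeries.coeff 1 f = l ∧
    ∀ i : ℕ, 2 ≤ i → ‖PowerSeries.coeff i f‖ ≤ 1}

/-- The quadratic polynomial `l x + x²`. -/
def quadP {p : ℕ} [Fact p.Prime] (l : ℂ_[p]) : PowerSeries ℂ_[p] :=
  PowerSeries.C l * PowerSeries.X + PowerSeries.X ^ 2

/-- `R(0) = 0`, and for `s ≥ 1` the distance `R(s) = p^(-1/(p^(s-1)(p-1)))` from `1` to the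
primitive `p^s`-th roots of unity. -/
def radR (p s : ℕ) : ℝ :=
  if s = 0 then 0 else (p : ℝ) ^ (-(1 / ((p : ℝ) ^ (s - 1) * ((p : ℝ) - 1))))

/-- The roots of unity of `p`-power order in `ℂ_[p]`. -/
def gammaR (p : ℕ) [Fact p.Prime] : Set ℂ_[p] :=
  {ζ | ∃ s : ℕ, ζ ^ p ^ s = 1}

/-- The least `n ≥ 1` with `|1 - l^n| < 1`. -/
def mOf {p : ℕ} [Fact p.Prime] (l : ℂ_[p]) : ℕ :=
  sInf {n : ℕ | 1 ≤ n ∧ ‖1 - l ^ n‖ < 1}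

/-- The integer `j ≥ 0` with `R(j) ≤ x < R(j+1)` (unique, and existing when `0 ≤ x < 1`). -/
def levelOf (p : ℕ) (x : ℝ) : ℕ :=
  sInf {j : ℕ | radR p j ≤ x ∧ x < radR p (j + 1)}

/-- The integer `s` with `R(s) ≤ |1 - l^m| < R(s+1)`. -/
def sOf {p : ℕ} [Fact p.Prime] (l : ℂ_[p]) : ℕ :=
  levelOf p ‖1 - l ^ mOf l‖

/-- A root of unity `γ₀` of `p`-power order that minimizes `|γ₀ - l^m|`. (The minimum is attained
when `|l| = 1`; everything below depends on `γ₀` only through that minimum.) -/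
def gammaZero {p : ℕ} [Fact p.Prime] (l : ℂ_[p]) : ℂ_[p] :=
  Classical.epsilon fun γ : ℂ_[p] =>
    γ ∈ gammaR p ∧ ∀ ζ ∈ gammaR p, ‖γ - l ^ mOf l‖ ≤ ‖ζ - l ^ mOf l‖

/-- The integer `t` with `R(t) ≤ |γ₀ - l^m| < R(t+1)`. -/
def tOf {p : ℕ} [Fact p.Prime] (l : ℂ_[p]) : ℕ :=
  levelOf p ‖gammaZero l - l ^ mOf l‖

/-- `r̃(l) = R(s+1)^(1/m) p^(-(s-t)/(m p^s)) |1 - l^m|^(s(p-1)/(mp)) |γ₀ - l^m|^(1/(m p^(s-t)))`. -/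
def rTilde {p : ℕ} [Fact p.Prime] (l : ℂ_[p]) : ℝ :=
  radR p (sOf l + 1) ^ (1 / (mOf l : ℝ)) *
  (p : ℝ) ^ (-(((sOf l : ℝ) - (tOf l : ℝ)) / ((mOf l : ℝ) * (p : ℝ) ^ sOf l))) *
  ‖1 - l ^ mOf l‖ ^ ((sOf l : ℝ) * (((p : ℝ) - 1) / ((mOf l : ℝ) * (p : ℝ)))) *
  ‖gammaZero l - l ^ mOf l‖ ^
    (1 / ((mOf l : ℝ) * (p : ℝ) ^ ((sOf l : ℤ) - (tOf l : ℤ))))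

end

-- Comparing coefficients in `H ∘ f = l H` determines `H` recursively: the coefficient of degree `n`
-- is a sum over lower degrees divided by `l - l ^ n`. The disk is therefore governed by the
-- absolute values of these coefficients, and the hypotheses on `a₂`, `a₃` make them computable
-- exactly (`norm_recCoeff_eq`).
--
-- Indeed, the recursion for degree `n + 1` has one strictly dominant term. If `p ∤ n`, it is the
-- one carrying `[f^n]_{n+1} = n l^(n-1) a₂`, a unit. If `p ∣ n`, that factor has size at most `1/p
-- < |1 - l|`, and the preceding term takes over: modulo the maximal ideal `l ≡ 1` and `n ≡ 0`, so
-- `[f^(n-1)]_{n+1} ≡ a₂² - a₃`, again a unit. The sizes thus form a product `coeffSize` depending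
-- only on `l`.
--
-- The logarithm of this product is a combination of floors `⌊n/p^i⌋` with nonnegative coefficients
-- beyond the linear term (`log_coeffSize`). Dropping the floors gives an upper bound linear in `n`,
-- attained at powers of `p`. The limiting slope is `-log r`: it is evaluated from `|1 - l^(p^i)|`,
-- a pure power law for `i < s`, division by `p` at each step from `s` on, and at `i = s` expressed
-- by the distance to the nearest root of unity (`norm_one_sub_pow_sOf`).
--
-- Hence `|H_k| r^k ≤ r`, which makes `H` and its inverse isometries of the open disk, while `|H_k|
-- r^k` stays constant and positive along `k = p^K + 1`, so `H` converges at no point with `|x| ≥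
-- r`. Since `H` is unique, no larger disk is possible (`isLinearizationDisk_ball`).

open Filter Topology

-- Ultrametric power series on disks; formal conjugacy and inversion.

section PowerSeriesOnDisks

variable {p : ℕ} [Fact p.Prime]

/-- The coefficients of `F` satisfy `|F_k| ρ^k ≤ C`. -/
def GaussBound (C ρ : ℝ) (F : PowerSeries ℂ_[p]) : Prop :=
  ∀ k : ℕ, ‖PowerSeries.coeff k F‖ * ρ ^ k ≤ C

theorem GaussBound.nonneg {C ρ : ℝ} {F : PowerSeries ℂ_[p]} (h : GaussBound C ρ F) : 0 ≤ C := by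
  have := h 0
  rw [pow_zero, mul_one] at this
  exact (norm_nonneg _).trans this

theorem GaussBound.mul {C D ρ : ℝ} (hρ : 0 < ρ) {F G : PowerSeries ℂ_[p]}
    (hF : GaussBound C ρ F) (hG : GaussBound D ρ G) : GaussBound (C * D) ρ (F * G) := by
  intro k
  have hk : 0 < ρ ^ k := pow_pos hρ k
  have hC := hF.nonneg
  have hD := hG.nonneg
  rw [← le_div_iff₀ hk, PowerSeries.coeff_mul]
  refine IsUltrametricDist.norm_sum_le_of_forall_le_of_nonneg (by positivity) ?_
  rintro ⟨i, j⟩ hij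
  rw [Finset.HasAntidiagonal.mem_antidiagonal] at hij
  simp only at hij ⊢
  rw [le_div_iff₀ hk, norm_mul, ← hij, pow_add]
  calc _ = (‖PowerSeries.coeff i F‖ * ρ ^ i) * (‖PowerSeries.coeff j G‖ * ρ ^ j) := by ring
    _ ≤ C * D := mul_le_mul (hF i) (hG j) (by positivity) hC

theorem GaussBound.pow {C ρ : ℝ} (hρ : 0 < ρ) {F : PowerSeries ℂ_[p]}
    (hF : GaussBound C ρ F) (n : ℕ) : GaussBound (C ^ n) ρ (F ^ n) := by
  induction n with
  | zero =>
    intro k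
    rw [pow_zero, pow_zero, PowerSeries.coeff_one]
    split_ifs with h
    · simp [h]
    · simp
  | succ n ih => rw [pow_succ, pow_succ]; exact ih.mul hρ hF

theorem GaussBound.norm_term_le {C ρ : ℝ} (hρ : 0 < ρ) {F : PowerSeries ℂ_[p]}
    (hF : GaussBound C ρ F) (x : ℂ_[p]) (n : ℕ) :
    ‖PowerSeries.coeff n F * x ^ n‖ ≤ C * (‖x‖ / ρ) ^ n := by
  rw [norm_mul, norm_pow, div_pow, ← mul_div_assoc, le_div_iff₀ (pow_pos hρ n)]
  calc _ = (‖PowerSeries.coeff n F‖ * ρ ^ n) * ‖x‖ ^ n := by ring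
    _ ≤ C * ‖x‖ ^ n := by gcongr; exact hF n

theorem GaussBound.summable_norm {C ρ : ℝ} {F : PowerSeries ℂ_[p]}
    (hF : GaussBound C ρ F) {x : ℂ_[p]} (hx : ‖x‖ < ρ) :
    Summable fun n : ℕ => ‖PowerSeries.coeff n F * x ^ n‖ := by
  have hρ : 0 < ρ := (norm_nonneg _).trans_lt hx
  refine Summable.of_nonneg_of_le (fun _ => norm_nonneg _) (hF.norm_term_le hρ x) ?_
  exact (summable_geometric_of_lt_one (by positivity) ((div_lt_one hρ).2 hx)).mul_left C

theorem psEval_mul {F G : PowerSeries ℂ_[p]} {x : ℂ_[p]}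
    (hF : Summable fun n : ℕ => ‖PowerSeries.coeff n F * x ^ n‖)
    (hG : Summable fun n : ℕ => ‖PowerSeries.coeff n G * x ^ n‖) :
    psEval (F * G) x = psEval F x * psEval G x := by
  unfold psEval
  rw [tsum_mul_tsum_eq_tsum_sum_antidiagonal_of_summable_norm hF hG]
  refine tsum_congr fun n => ?_
  rw [PowerSeries.coeff_mul, Finset.sum_mul]
  refine Finset.sum_congr rfl ?_
  rintro ⟨i, j⟩ hij
  rw [Finset.HasAntidiagonal.mem_antidiagonal] at hij
  simp only at hij ⊢
  rw [← hij, pow_add]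
  ring

theorem psEval_pow {C ρ : ℝ} {F : PowerSeries ℂ_[p]} (hF : GaussBound C ρ F) {x : ℂ_[p]}
    (hx : ‖x‖ < ρ) (n : ℕ) : psEval (F ^ n) x = psEval F x ^ n := by
  have hρ : 0 < ρ := (norm_nonneg _).trans_lt hx
  induction n with
  | zero =>
    unfold psEval
    rw [pow_zero, pow_zero, tsum_eq_single 0]
    · simp
    · intro m hm
      simp [PowerSeries.coeff_one, hm]
  | succ n ih =>
    rw [pow_succ, psEval_mul ((hF.pow hρ n).summable_norm hx) (hF.summable_norm hx), ih, pow_succ]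

theorem coeff_pow_eq_zero_of_lt {R : Type*} [CommRing R] {F : PowerSeries R}
    (h0 : PowerSeries.coeff 0 F = 0) {i n : ℕ} (h : n < i) : PowerSeries.coeff n (F ^ i) = 0 := by
  have hX : PowerSeries.X ∣ F := by
    rw [PowerSeries.X_dvd_iff, ← PowerSeries.coeff_zero_eq_constantCoeff_apply, h0]
  exact PowerSeries.X_pow_dvd_iff.1 (pow_dvd_pow_of_dvd hX i) n h

/-- Evaluation of a composition of power series, for `F` preserving the disk of radius `ρ`. -/
theorem psEval_psEval {C ρ : ℝ} {W F : PowerSeries ℂ_[p]} (hW : GaussBound C ρ W)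
    (hF : GaussBound ρ ρ F) (hF0 : PowerSeries.coeff 0 F = 0) {x : ℂ_[p]} (hx : ‖x‖ < ρ) :
    psEval W (psEval F x) = psEval (PowerSeries.mk fun n => ∑ i ∈ Finset.range (n + 1),
      PowerSeries.coeff i W * PowerSeries.coeff n (F ^ i)) x := by
  have hρ : 0 < ρ := (norm_nonneg _).trans_lt hx
  have hC := hW.nonneg
  set a : ℕ → ℕ → ℂ_[p] := fun i n =>
    PowerSeries.coeff i W * (PowerSeries.coeff n (F ^ i) * x ^ n) with ha
  -- Only `n ≥ i` contributes, and there `(‖x‖/ρ)^n = s^n s^n ≤ s^i s^n`: the square root turns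
  -- decay in `n` alone into a summable bound in both indices.
  set s : ℝ := Real.sqrt (‖x‖ / ρ) with hs
  have hs0 : 0 ≤ s := Real.sqrt_nonneg _
  have hsq : s * s = ‖x‖ / ρ := Real.mul_self_sqrt (by positivity)
  have hs1 : s < 1 := by
    rw [hs, Real.sqrt_lt' one_pos, one_pow]
    exact (div_lt_one hρ).2 hx
  have hzero : ∀ i n, n < i → a i n = 0 := fun i n h => by
    simp only [ha, coeff_pow_eq_zero_of_lt hF0 h, zero_mul, mul_zero]
  have hbound : ∀ i n, ‖a i n‖ ≤ C * (s ^ i * s ^ n) := by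
    intro i n
    rcases lt_or_ge n i with h | h
    · rw [hzero i n h, norm_zero]; positivity
    · have h1 : ‖a i n‖ ≤ C * (‖x‖ / ρ) ^ n := by
        have hi := pow_pos hρ i
        rw [← mul_le_mul_iff_left₀ hi]
        calc ‖a i n‖ * ρ ^ i = (‖PowerSeries.coeff i W‖ * ρ ^ i) *
              ‖PowerSeries.coeff n (F ^ i) * x ^ n‖ := by rw [ha]; simp only [norm_mul]; ring
          _ ≤ C * (ρ ^ i * (‖x‖ / ρ) ^ n) :=
              mul_le_mul (hW i) ((hF.pow hρ i).norm_term_le hρ x n) (norm_nonneg _) hC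
          _ = _ := by ring
      refine h1.trans ?_
      rw [← hsq, mul_pow]
      gcongr ?_ * (?_ * _)
      exact pow_le_pow_of_le_one hs0 hs1.le h
  have hsum : Summable (Function.uncurry a) := by
    have hg := summable_geometric_of_lt_one hs0 hs1
    have := (hg.mul_of_nonneg hg (fun _ => by positivity) (fun _ => by positivity)).mul_left C
    exact Summable.of_norm_bounded this fun x => hbound x.1 x.2
  calc psEval W (psEval F x) = ∑' i, ∑' n, a i n := by
        unfold psEval
        refine tsum_congr fun i => ?_
        rw [tsum_mul_left]
        congr 1
        exact (psEval_pow hF hx i).symm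
    _ = ∑' n, ∑' i, a i n := hsum.tsum_comm.symm
    _ = _ := by
        unfold psEval
        refine tsum_congr fun n => ?_
        rw [tsum_eq_sum (s := Finset.range (n + 1)), PowerSeries.coeff_mk, Finset.sum_mul]
        · exact Finset.sum_congr rfl fun i _ => by rw [ha]; ring
        · intro i hi
          exact hzero i n (by simpa using hi)

theorem norm_pow_sub_pow_le {K : Type*} [NormedField K] [IsUltrametricDist K] {x y : K} {q : ℝ}
    (hx : ‖x‖ ≤ q) (hy : ‖y‖ ≤ q) (n : ℕ) : ‖x ^ (n + 1) - y ^ (n + 1)‖ ≤ ‖x - y‖ * q ^ n := by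
  have hq : 0 ≤ q := (norm_nonneg _).trans hx
  rw [← (Commute.all x y).mul_geom_sum₂, norm_mul]
  refine mul_le_mul_of_nonneg_left ?_ (norm_nonneg _)
  refine IsUltrametricDist.norm_sum_le_of_forall_le_of_nonneg (by positivity) fun i hi => ?_
  rw [Finset.mem_range] at hi
  rw [norm_mul, norm_pow, norm_pow]
  calc ‖x‖ ^ i * ‖y‖ ^ (n + 1 - 1 - i) ≤ q ^ i * q ^ (n + 1 - 1 - i) := by gcongr
    _ = q ^ n := by rw [← pow_add]; congr 1; omega

theorem norm_add_eq_of_norm_lt {K : Type*} [SeminormedAddGroup K] [IsUltrametricDist K] {x y : K}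
    (h : ‖y‖ < ‖x‖) : ‖x + y‖ = ‖x‖ := by
  rw [IsUltrametricDist.norm_add_eq_max_of_norm_ne_norm h.ne', max_eq_left h.le]

/-- A series with linear coefficient of norm one satisfying the Gauss bound is an isometry. -/
theorem norm_psEval_sub_psEval {ρ : ℝ} {F : PowerSeries ℂ_[p]} (hF : GaussBound ρ ρ F)
    (h1 : ‖PowerSeries.coeff 1 F‖ = 1) {x y : ℂ_[p]} (hx : ‖x‖ < ρ) (hy : ‖y‖ < ρ) :
    ‖psEval F x - psEval F y‖ = ‖x - y‖ := by
  have hρ : 0 < ρ := (norm_nonneg _).trans_lt hx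
  rcases eq_or_ne x y with rfl | hxy
  · simp
  have hd : 0 < ‖x - y‖ := norm_pos_iff.2 (sub_ne_zero.2 hxy)
  set q := max ‖x‖ ‖y‖ with hq
  have hq0 : 0 ≤ q := (norm_nonneg x).trans (le_max_left _ _)
  have hqρ : q < ρ := max_lt hx hy
  have hq1 : q / ρ < 1 := (div_lt_one hρ).2 hqρ
  have sx := (hF.summable_norm hx).of_norm
  have sy := (hF.summable_norm hy).of_norm
  have key : psEval F x - psEval F y = PowerSeries.coeff 1 F * (x - y) +
      ∑' n : ℕ, (PowerSeries.coeff (n + 2) F * x ^ (n + 2) -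
        PowerSeries.coeff (n + 2) F * y ^ (n + 2)) := by
    unfold psEval
    rw [← sx.tsum_sub sy, ← (sx.sub sy).sum_add_tsum_nat_add 2]
    simp [Finset.sum_range_succ, mul_sub]
  have hc : ‖PowerSeries.coeff 1 F * (x - y)‖ = ‖x - y‖ := by rw [norm_mul, h1, one_mul]
  rw [key, norm_add_eq_of_norm_lt, hc]
  rw [hc]
  -- All terms of degree at least two share the bound `‖x - y‖ * (q / ρ)`, so their infinite sum
  -- stays strictly below the linear term.
  refine lt_of_le_of_lt (IsUltrametricDist.norm_tsum_le_of_forall_le_of_nonneg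
    (C := ‖x - y‖ * (q / ρ)) (by positivity) fun n => ?_) (mul_lt_of_lt_one_right hd hq1)
  rw [← mul_sub, norm_mul]
  calc ‖PowerSeries.coeff (n + 2) F‖ * ‖x ^ (n + 2) - y ^ (n + 2)‖
      ≤ ‖PowerSeries.coeff (n + 2) F‖ * (‖x - y‖ * q ^ (n + 1)) := by
        gcongr
        exact norm_pow_sub_pow_le (le_max_left _ _) (le_max_right _ _) (n + 1)
    _ = (‖PowerSeries.coeff (n + 2) F‖ * ρ ^ (n + 2)) * (‖x - y‖ * (q / ρ) ^ (n + 1)) / ρ := by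
        rw [div_pow]; field_simp; ring
    _ ≤ ρ * (‖x - y‖ * (q / ρ) ^ (n + 1)) / ρ := by gcongr; exact hF _
    _ = ‖x - y‖ * (q / ρ) * (q / ρ) ^ n := by rw [pow_succ]; field_simp
    _ ≤ ‖x - y‖ * (q / ρ) := mul_le_of_le_one_right (by positivity)
        (pow_le_one₀ (by positivity) hq1.le)

theorem psEval_zero {F : PowerSeries ℂ_[p]} (h0 : PowerSeries.coeff 0 F = 0) :
    psEval F 0 = 0 := by
  unfold psEval
  rw [tsum_eq_single 0]
  · simpa using h0
  · intro n hn
    simp [hn]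

theorem norm_psEval {ρ : ℝ} {F : PowerSeries ℂ_[p]} (hF : GaussBound ρ ρ F)
    (h0 : PowerSeries.coeff 0 F = 0) (h1 : ‖PowerSeries.coeff 1 F‖ = 1) {x : ℂ_[p]}
    (hx : ‖x‖ < ρ) : ‖psEval F x‖ = ‖x‖ := by
  have hρ : 0 < ρ := (norm_nonneg _).trans_lt hx
  have := norm_psEval_sub_psEval hF h1 hx (y := 0) (by simpa using hρ)
  simpa [psEval_zero h0] using this

theorem coeff_eq_zero_of_psEval_eq_zero {C ρ : ℝ} (hρ : 0 < ρ) {F : PowerSeries ℂ_[p]}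
    (hF : GaussBound C ρ F) (h : ∀ x : ℂ_[p], ‖x‖ < ρ → psEval F x = 0) (n : ℕ) :
    PowerSeries.coeff n F = 0 := by
  have hC := hF.nonneg
  induction n using Nat.strong_induction_on with
  | _ n ih =>
  by_contra hn
  have hn' : 0 < ‖PowerSeries.coeff n F‖ := norm_pos_iff.2 hn
  -- At a point this small the lowest nonzero term would outweigh the whole tail; `C + 1` avoids
  -- dividing by zero.
  obtain ⟨x, hx0, hx⟩ := NormedField.exists_norm_lt ℂ_[p]
    (r := min ρ (‖PowerSeries.coeff n F‖ * ρ ^ (n + 1) / (C + 1))) (by positivity)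
  have hxρ : ‖x‖ < ρ := hx.trans_le (min_le_left _ _)
  have hx2 := hx.trans_le (min_le_right _ _)
  have hq1 : ‖x‖ / ρ ≤ 1 := ((div_lt_one hρ).2 hxρ).le
  have hev := h x hxρ
  unfold psEval at hev
  rw [← ((hF.summable_norm hxρ).of_norm).sum_add_tsum_nat_add (n + 1), Finset.sum_range_succ,
    Finset.sum_eq_zero (fun i hi => by rw [ih i (Finset.mem_range.1 hi), zero_mul]), zero_add] at hev
  have hle : ‖PowerSeries.coeff n F * x ^ n‖ ≤ C * (‖x‖ / ρ) ^ (n + 1) := by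
    rw [eq_neg_of_add_eq_zero_left hev, norm_neg]
    refine IsUltrametricDist.norm_tsum_le_of_forall_le_of_nonneg (by positivity) fun i => ?_
    refine (hF.norm_term_le hρ x _).trans ?_
    gcongr ?_ * ?_
    exact pow_le_pow_of_le_one (by positivity) hq1 (by omega)
  rw [norm_mul, norm_pow, div_pow, ← mul_div_assoc, le_div_iff₀ (by positivity),
    pow_succ ‖x‖ n] at hle
  have hxn : 0 < ‖x‖ ^ n := pow_pos hx0 n
  have hle' : ‖PowerSeries.coeff n F‖ * ρ ^ (n + 1) ≤ C * ‖x‖ := by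
    refine le_of_mul_le_mul_right ?_ hxn
    linarith
  rw [lt_div_iff₀ (by positivity)] at hx2
  nlinarith

/-- The solution `w` of `w_n d_n = ∑_{i < n} w_i [F^i]_n` with `w_0 = 0` and `w_1 = 1`. -/
noncomputable def recCoeff (F : PowerSeries ℂ_[p]) (d : ℕ → ℂ_[p]) (n : ℕ) : ℂ_[p] :=
  if n = 0 then 0 else if n = 1 then 1 else
    (∑ i : Fin n, recCoeff F d i * PowerSeries.coeff n (F ^ (i : ℕ))) / d n
termination_by n
decreasing_by exact i.2

theorem recCoeff_zero (F : PowerSeries ℂ_[p]) (d : ℕ → ℂ_[p]) : recCoeff F d 0 = 0 := by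
  rw [recCoeff, if_pos rfl]

theorem recCoeff_one (F : PowerSeries ℂ_[p]) (d : ℕ → ℂ_[p]) : recCoeff F d 1 = 1 := by
  rw [recCoeff, if_neg one_ne_zero, if_pos rfl]

theorem recCoeff_of_two_le (F : PowerSeries ℂ_[p]) (d : ℕ → ℂ_[p]) {n : ℕ} (hn : 2 ≤ n) :
    recCoeff F d n =
      (∑ i ∈ Finset.range n, recCoeff F d i * PowerSeries.coeff n (F ^ i)) / d n := by
  rw [recCoeff, if_neg (by omega), if_neg (by omega),
    Fin.sum_univ_eq_sum_range (fun i => recCoeff F d i * PowerSeries.coeff n (F ^ i)) n]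

theorem coeff_self_pow {R : Type*} [CommRing R] {F : PowerSeries R}
    (h0 : PowerSeries.coeff 0 F = 0) (n : ℕ) :
    PowerSeries.coeff n (F ^ n) = PowerSeries.coeff 1 F ^ n := by
  obtain ⟨g, rfl⟩ : PowerSeries.X ∣ F := by
    rw [PowerSeries.X_dvd_iff, ← PowerSeries.coeff_zero_eq_constantCoeff_apply, h0]
  have := PowerSeries.coeff_X_pow_mul (g ^ n) n 0
  rw [zero_add] at this
  rw [mul_pow, this]
  have h1 := PowerSeries.coeff_succ_X_mul 0 g
  rw [zero_add] at h1
  rw [h1]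
  simp

/-- The series conjugating `f` to multiplication by `l`. -/
noncomputable def conjSeries (f : PowerSeries ℂ_[p]) (l : ℂ_[p]) : PowerSeries ℂ_[p] :=
  PowerSeries.mk (recCoeff f fun n => l - l ^ n)

/-- The compositional left inverse of a series `F` with linear coefficient one. -/
noncomputable def invSeries (F : PowerSeries ℂ_[p]) : PowerSeries ℂ_[p] :=
  PowerSeries.mk (recCoeff F fun _ => -1)

theorem gaussBound_invSeries {ρ : ℝ} (hρ : 0 < ρ) {F : PowerSeries ℂ_[p]}
    (hF : GaussBound ρ ρ F) : GaussBound ρ ρ (invSeries F) := by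
  intro n
  rw [invSeries, PowerSeries.coeff_mk]
  induction n using Nat.strong_induction_on with
  | _ n ih =>
  rcases Nat.lt_or_ge n 2 with h | h
  · interval_cases n
    · rw [recCoeff_zero]; simpa using hρ.le
    · rw [recCoeff_one]; simp
  · rw [recCoeff_of_two_le _ _ h, norm_div, norm_neg, norm_one, div_one,
      ← le_div_iff₀ (pow_pos hρ n)]
    refine IsUltrametricDist.norm_sum_le_of_forall_le_of_nonneg (by positivity) fun i hi => ?_
    rw [le_div_iff₀ (pow_pos hρ n), norm_mul]
    have hi' := pow_pos hρ i
    rw [← mul_le_mul_iff_left₀ hi']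
    calc _ = (‖recCoeff F (fun _ => -1) i‖ * ρ ^ i) * (‖PowerSeries.coeff n (F ^ i)‖ * ρ ^ n) := by
          ring
      _ ≤ ρ * ρ ^ i := mul_le_mul (ih i (Finset.mem_range.1 hi)) (hF.pow hρ i n) (by positivity)
          hρ.le

/-- With `d = -1` and `[F^n]_n = 1`, the recursion says exactly that the coefficients of the
composition vanish in degrees at least two. -/
theorem psEval_invSeries {ρ : ℝ} {F : PowerSeries ℂ_[p]} (hF : GaussBound ρ ρ F)
    (h0 : PowerSeries.coeff 0 F = 0) (h1 : PowerSeries.coeff 1 F = 1) {x : ℂ_[p]}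
    (hx : ‖x‖ < ρ) : psEval (invSeries F) (psEval F x) = x := by
  have hρ : 0 < ρ := (norm_nonneg _).trans_lt hx
  rw [psEval_psEval (gaussBound_invSeries hρ hF) hF h0 hx]
  unfold psEval
  rw [tsum_eq_single 1]
  · simp [invSeries, Finset.sum_range_succ, recCoeff_zero, recCoeff_one, h1]
  · intro n hn
    rw [PowerSeries.coeff_mk]
    rcases Nat.lt_or_ge n 2 with h | h
    · obtain rfl : n = 0 := by omega
      simp [invSeries, recCoeff_zero]
    · rw [Finset.sum_range_succ]
      simp only [invSeries, PowerSeries.coeff_mk]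
      rw [recCoeff_of_two_le F _ h, coeff_self_pow h0, h1, one_pow, mul_one, div_neg,
        div_one, add_neg_cancel, zero_mul]

/-- Since `[f^n]_n = l^n`, the recursion with `d n = l - l ^ n` is the functional equation read
coefficient by coefficient. -/
theorem psEval_conjSeries {C ρ : ℝ} {f : PowerSeries ℂ_[p]} {l : ℂ_[p]}
    (hH : GaussBound C ρ (conjSeries f l)) (hf : GaussBound ρ ρ f)
    (h0 : PowerSeries.coeff 0 f = 0) (h1 : PowerSeries.coeff 1 f = l)
    (hl : ∀ n, 2 ≤ n → l - l ^ n ≠ 0) {x : ℂ_[p]} (hx : ‖x‖ < ρ) :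
    psEval (conjSeries f l) (psEval f x) = l * psEval (conjSeries f l) x := by
  rw [psEval_psEval hH hf h0 hx]
  unfold psEval
  rw [← tsum_mul_left]
  refine tsum_congr fun n => ?_
  rw [← mul_assoc]
  congr 1
  rw [PowerSeries.coeff_mk]
  simp only [conjSeries, PowerSeries.coeff_mk]
  rcases Nat.lt_or_ge n 2 with h | h
  · interval_cases n
    · simp [recCoeff_zero]
    · simp [Finset.sum_range_succ, recCoeff_zero, recCoeff_one, h1]
  · rw [Finset.sum_range_succ, coeff_self_pow h0, h1]
    have := recCoeff_of_two_le f (fun n => l - l ^ n) h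
    rw [eq_div_iff (hl n h)] at this
    rw [← this]
    ring

/-- A convergent solution of the linearization equation is `conjSeries`. -/
theorem eq_conjSeries {C ρ : ℝ} (hρ : 0 < ρ) {f H : PowerSeries ℂ_[p]} {l : ℂ_[p]}
    (hH : GaussBound C ρ H) (hf : GaussBound ρ ρ f) (hl1 : ‖l‖ ≤ 1)
    (h0 : PowerSeries.coeff 0 f = 0) (h1 : PowerSeries.coeff 1 f = l)
    (hl : ∀ n, 2 ≤ n → l - l ^ n ≠ 0)
    (H0 : PowerSeries.coeff 0 H = 0) (H1 : PowerSeries.coeff 1 H = 1)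
    (hconj : ∀ x : ℂ_[p], ‖x‖ < ρ → psEval H (psEval f x) = l * psEval H x) :
    H = conjSeries f l := by
  have hC := hH.nonneg
  set S : PowerSeries ℂ_[p] := PowerSeries.mk fun n => ∑ i ∈ Finset.range (n + 1),
      PowerSeries.coeff i H * PowerSeries.coeff n (f ^ i) with hS
  have hSb : GaussBound C ρ S := by
    intro n
    rw [hS, PowerSeries.coeff_mk, ← le_div_iff₀ (pow_pos hρ n)]
    refine IsUltrametricDist.norm_sum_le_of_forall_le_of_nonneg (by positivity) fun i hi => ?_
    rw [le_div_iff₀ (pow_pos hρ n), norm_mul]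
    have hi' := pow_pos hρ i
    rw [← mul_le_mul_iff_left₀ hi']
    calc _ = (‖PowerSeries.coeff i H‖ * ρ ^ i) * (‖PowerSeries.coeff n (f ^ i)‖ * ρ ^ n) := by
          ring
      _ ≤ C * ρ ^ i := mul_le_mul (hH i) (hf.pow hρ i n) (by positivity) hC
  have hdiff : ∀ n, PowerSeries.coeff n (S - PowerSeries.C l * H) = 0 := by
    refine coeff_eq_zero_of_psEval_eq_zero hρ (C := C) ?_ ?_
    · intro n
      rw [map_sub, PowerSeries.coeff_C_mul, ← le_div_iff₀ (pow_pos hρ n), sub_eq_add_neg]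
      refine (IsUltrametricDist.norm_add_le_max _ _).trans (max_le ?_ ?_)
      · rw [le_div_iff₀ (pow_pos hρ n)]; exact hSb n
      · rw [norm_neg, norm_mul, le_div_iff₀ (pow_pos hρ n), mul_assoc]
        exact (mul_le_of_le_one_left (by positivity) hl1).trans (hH n)
    · intro x hx
      have e := hconj x hx
      rw [psEval_psEval hH hf h0 hx, ← hS] at e
      have : psEval (S - PowerSeries.C l * H) x = psEval S x - l * psEval H x := by
        unfold psEval
        rw [← tsum_mul_left, ← ((hSb.summable_norm hx).of_norm).tsum_sub
          (((hH.summable_norm hx).of_norm).mul_left l)]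
        refine tsum_congr fun n => ?_
        rw [map_sub, PowerSeries.coeff_C_mul]
        ring
      rw [this, e, sub_self]
  ext n
  rw [conjSeries, PowerSeries.coeff_mk]
  induction n using Nat.strong_induction_on with
  | _ n ih =>
  rcases Nat.lt_or_ge n 2 with h | h
  · interval_cases n
    · rw [H0, recCoeff_zero]
    · rw [H1, recCoeff_one]
  · have := hdiff n
    rw [map_sub, PowerSeries.coeff_C_mul, hS, PowerSeries.coeff_mk, Finset.sum_range_succ,
      coeff_self_pow h0, h1] at this
    rw [recCoeff_of_two_le _ _ h, eq_div_iff (hl n h)]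
    have hs : ∑ i ∈ Finset.range n, PowerSeries.coeff i H * PowerSeries.coeff n (f ^ i) =
        ∑ i ∈ Finset.range n, recCoeff f (fun n => l - l ^ n) i * PowerSeries.coeff n (f ^ i) :=
      Finset.sum_congr rfl fun i hi => by rw [ih i (Finset.mem_range.1 hi)]
    rw [← hs]
    linear_combination -this

theorem exists_gaussBound {H : PowerSeries ℂ_[p]} {x : ℂ_[p]}
    (h : Summable fun n : ℕ => PowerSeries.coeff n H * x ^ n) : ∃ C, GaussBound C ‖x‖ H := by
  obtain ⟨C, hC⟩ := h.tendsto_atTop_zero.norm.bddAbove_range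
  refine ⟨C, fun k => ?_⟩
  have := hC ⟨k, rfl⟩
  simpa using this

theorem gaussBound_of_mem_classG {f : PowerSeries ℂ_[p]} {l : ℂ_[p]} (hf : f ∈ classG l) {r : ℝ}
    (hr : 0 < r) (hr1 : r ≤ 1) : GaussBound r r f := by
  obtain ⟨⟨hl, -⟩, h0, h1, h2⟩ := hf
  intro k
  rcases Nat.lt_or_ge k 2 with h | h
  · interval_cases k
    · rw [h0]; simpa using hr.le
    · rw [h1, hl]; simp
  · calc _ ≤ 1 * r ^ k := by gcongr; exact h2 k h
      _ ≤ r := by rw [one_mul]; exact pow_le_of_le_one hr.le hr1 (by omega)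

theorem sub_pow_ne_zero_of_mem_classG {f : PowerSeries ℂ_[p]} {l : ℂ_[p]} (hf : f ∈ classG l)
    (n : ℕ) (hn : 2 ≤ n) : l - l ^ n ≠ 0 := by
  obtain ⟨⟨hl, hroot⟩, -⟩ := hf
  obtain ⟨m, rfl⟩ : ∃ m, n = m + 1 := ⟨n - 1, by omega⟩
  have h0 : l ≠ 0 := norm_pos_iff.1 (by rw [hl]; exact one_pos)
  have : l - l ^ (m + 1) = l * (1 - l ^ m) := by ring
  rw [this]
  exact mul_ne_zero h0 (sub_ne_zero.2 (hroot m (by omega)).symm)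

/-- Criterion for the open disk of radius `r` to be the linearization disk. -/
theorem isLinearizationDisk_ball {f : PowerSeries ℂ_[p]} {l : ℂ_[p]} (hf : f ∈ classG l) {r : ℝ}
    (hr : 0 < r) (hr1 : r ≤ 1) (hb : GaussBound r r (conjSeries f l))
    (hnot : ¬ Tendsto (fun k => ‖PowerSeries.coeff k (conjSeries f l)‖ * r ^ k) atTop (𝓝 0)) :
    IsLinearizationDisk f (Metric.ball 0 r) := by
  have hfb := gaussBound_of_mem_classG hf hr hr1
  have hl := sub_pow_ne_zero_of_mem_classG hf
  have hff := hf
  obtain ⟨⟨hl1, hroot⟩, h0, h1, h2⟩ := hf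
  have H0 : PowerSeries.coeff 0 (conjSeries f l) = 0 := by
    rw [conjSeries, PowerSeries.coeff_mk, recCoeff_zero]
  have H1 : PowerSeries.coeff 1 (conjSeries f l) = 1 := by
    rw [conjSeries, PowerSeries.coeff_mk, recCoeff_one]
  have hG := gaussBound_invSeries hr hb
  have G0 : PowerSeries.coeff 0 (invSeries (conjSeries f l)) = 0 := by
    rw [invSeries, PowerSeries.coeff_mk, recCoeff_zero]
  have G1 : PowerSeries.coeff 1 (invSeries (conjSeries f l)) = 1 := by
    rw [invSeries, PowerSeries.coeff_mk, recCoeff_one]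
  have nH : ∀ {x : ℂ_[p]}, ‖x‖ < r → ‖psEval (conjSeries f l) x‖ = ‖x‖ := fun hx =>
    norm_psEval hb H0 (by rw [H1, norm_one]) hx
  have nG : ∀ {x : ℂ_[p]}, ‖x‖ < r → ‖psEval (invSeries (conjSeries f l)) x‖ = ‖x‖ := fun hx =>
    norm_psEval hG G0 (by rw [G1, norm_one]) hx
  have GH : ∀ {x : ℂ_[p]}, ‖x‖ < r →
      psEval (invSeries (conjSeries f l)) (psEval (conjSeries f l) x) = x := fun hx =>
    psEval_invSeries hb H0 H1 hx
  have HG : ∀ {x : ℂ_[p]}, ‖x‖ < r →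
      psEval (conjSeries f l) (psEval (invSeries (conjSeries f l)) x) = x := fun {x} hx => by
    have hgx := (nG hx).trans_lt hx
    -- The left inverse is also a right inverse, because an isometry `G` with `G (H (G x)) = G x` is
    -- injective.
    have := norm_psEval_sub_psEval hG (by rw [G1, norm_one]) ((nH hgx).trans_lt hgx) hx
    rw [GH hgx, sub_self, norm_zero] at this
    exact sub_eq_zero.1 (norm_eq_zero.1 this.symm)
  constructor
  · refine ⟨⟨r, hr, Or.inl rfl⟩, ?_, ?_, conjSeries f l, invSeries (conjSeries f l),
      Metric.ball 0 r, ⟨r, hr, Or.inl rfl⟩, H0, H1, ?_, ?_, ?_, ?_, ⟨?_, ?_⟩, ?_⟩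
    · exact fun x hx => (hfb.summable_norm (mem_ball_zero_iff.1 hx)).of_norm
    · intro x hx
      rw [mem_ball_zero_iff] at hx ⊢
      rwa [norm_psEval hfb h0 (by rw [h1, hl1]) hx]
    · exact fun x hx => (hb.summable_norm (mem_ball_zero_iff.1 hx)).of_norm
    · exact fun x hx => (hG.summable_norm (mem_ball_zero_iff.1 hx)).of_norm
    · intro x hx
      rw [mem_ball_zero_iff] at hx ⊢
      rwa [nH hx]
    · intro x hx
      rw [mem_ball_zero_iff] at hx ⊢
      rwa [nG hx]
    · exact fun x hx => GH (mem_ball_zero_iff.1 hx)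
    · exact fun x hx => HG (mem_ball_zero_iff.1 hx)
    · intro z hz
      rw [mem_ball_zero_iff] at hz
      rw [psEval_conjSeries hb hfb h0 h1 hl ((nG hz).trans_lt hz), HG hz, h1]
  · rintro D ⟨⟨ρ, hρ, hD⟩, -, hfD, H, G, E, -, H0', H1', hHD, -, hHE, -, ⟨hGH, -⟩, hconj⟩
    have hball : Metric.ball (0 : ℂ_[p]) ρ ⊆ D := by
      rcases hD with rfl | rfl
      · exact subset_rfl
      · exact Metric.ball_subset_closedBall
    have hHf : ∀ x ∈ D, psEval H (psEval f x) = l * psEval H x := fun x hx => by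
      have := hconj _ (hHE hx)
      rwa [hGH hx, h1] at this
    -- Uniqueness is applied on a small disk whose radius is the norm of an actual point, where
    -- convergence yields a Gauss bound.
    obtain ⟨y, hy0, hy⟩ := NormedField.exists_norm_lt ℂ_[p] (r := min ρ r) (lt_min hρ hr)
    have hyD : y ∈ D := hball (mem_ball_zero_iff.2 (hy.trans_le (min_le_left _ _)))
    obtain ⟨C, hC⟩ := exists_gaussBound (hHD y hyD)
    have hyr := hy.trans_le (min_le_right _ _)
    have hH : H = conjSeries f l := by
      refine eq_conjSeries hy0 hC (gaussBound_of_mem_classG hff hy0 (hyr.le.trans hr1)) hl1.le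
        h0 h1 hl H0' H1' fun x hx => hHf x (hball (mem_ball_zero_iff.2 ?_))
      exact hx.trans (hy.trans_le (min_le_left _ _))
    intro x hx
    rw [mem_ball_zero_iff]
    by_contra hxr
    rw [not_lt] at hxr
    -- Convergence at a point with `‖x‖ ≥ r` would force the terms `‖H_k‖ r^k` to tend to zero.
    refine hnot (squeeze_zero (fun k => by positivity) (fun k => ?_)
      (hH ▸ (hHD x hx).tendsto_atTop_zero.norm |>.trans (by rw [norm_zero])))
    rw [norm_mul, norm_pow]
    gcongr

end PowerSeriesOnDisks

-- Distance from `1` to the powers of a unit near `1`.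

section UnitPowers

variable {p : ℕ} [hp : Fact p.Prime]

theorem norm_natCast_self : ‖(p : ℂ_[p])‖ = 1 / p := by
  have := PadicComplex.norm_extends' p (p : ℚ_[p])
  simpa using this

theorem norm_natCast_of_not_dvd {n : ℕ} (h : ¬ p ∣ n) : ‖(n : ℂ_[p])‖ = 1 := by
  have := PadicComplex.norm_extends' p (n : ℚ_[p])
  rw [show ‖(n : ℚ_[p])‖ = 1 by
    rw [Padic.norm_natCast_eq_one_iff]; exact (Nat.Prime.coprime_iff_not_dvd hp.out).2 h] at this
  simpa using this

theorem norm_natCast_le_of_dvd {n : ℕ} (h : p ∣ n) : ‖(n : ℂ_[p])‖ ≤ 1 / p := by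
  obtain ⟨m, rfl⟩ := h
  rw [Nat.cast_mul, norm_mul, norm_natCast_self]
  exact mul_le_of_le_one_right (by positivity) (IsUltrametricDist.norm_natCast_le_one _ m)

theorem norm_eq_one_of_norm_one_sub_lt {K : Type*} [NormedField K] [IsUltrametricDist K] {x : K}
    (hx : ‖1 - x‖ < 1) : ‖x‖ = 1 := by
  have : x = 1 + -(1 - x) := by ring
  rw [this, norm_add_eq_of_norm_lt, norm_one]
  rwa [norm_neg, norm_one]

theorem norm_one_sub_pow_le {K : Type*} [NormedField K] [IsUltrametricDist K] {x : K}
    (hx : ‖x‖ ≤ 1) (n : ℕ) : ‖1 - x ^ n‖ ≤ ‖1 - x‖ := by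
  rw [← mul_neg_geom_sum, norm_mul]
  refine mul_le_of_le_one_right (norm_nonneg _) ?_
  refine IsUltrametricDist.norm_sum_le_of_forall_le_of_nonneg zero_le_one fun i _ => ?_
  rw [norm_pow]
  exact pow_le_one₀ (norm_nonneg _) hx

/-- The cofactor `1 + x + ... + x^(n-1)` is congruent to `n` modulo the maximal ideal, hence a unit.
-/
theorem norm_one_sub_pow_of_not_dvd {x : ℂ_[p]} (hx : ‖1 - x‖ < 1) {n : ℕ} (h : ¬ p ∣ n) :
    ‖1 - x ^ n‖ = ‖1 - x‖ := by
  have hx1 := norm_eq_one_of_norm_one_sub_lt hx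
  rw [← mul_neg_geom_sum, norm_mul]
  have : ∑ i ∈ Finset.range n, x ^ i = n + ∑ i ∈ Finset.range n, -(1 - x ^ i) := by
    simp [Finset.sum_sub_distrib]
  rw [this, norm_add_eq_of_norm_lt, norm_natCast_of_not_dvd h, mul_one]
  rw [norm_natCast_of_not_dvd h]
  refine lt_of_le_of_lt ?_ hx
  refine IsUltrametricDist.norm_sum_le_of_forall_le_of_nonneg (norm_nonneg _) fun i _ => ?_
  rw [norm_neg]
  exact norm_one_sub_pow_le hx1.le i

/-- Up to an error of size `|1 - x|² / p`, only the extreme terms of `(1 - (1 - x))^p` matter. -/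
theorem exists_one_sub_pow_prime {x : ℂ_[p]} (hx : ‖1 - x‖ < 1) (hp2 : p ≠ 2) :
    ∃ e : ℂ_[p], ‖e‖ ≤ ‖1 - x‖ ^ 2 / p ∧ 1 - x ^ p = (1 - x) ^ p + (p * (1 - x) + e) := by
  set y := 1 - x with hy
  have hx' : x = -y + 1 := by rw [hy]; ring
  have hodd : Odd p := hp.out.odd_of_ne_two hp2
  obtain ⟨q, hq⟩ : ∃ q, p = q + 2 := ⟨p - 2, by have := hp.out.two_le; omega⟩
  refine ⟨-∑ i ∈ Finset.range q, (-y) ^ (i + 2) * (p.choose (i + 2) : ℂ_[p]), ?_, ?_⟩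
  · rw [norm_neg]
    refine IsUltrametricDist.norm_sum_le_of_forall_le_of_nonneg (by positivity) fun i hi => ?_
    rw [Finset.mem_range] at hi
    rw [norm_mul, norm_pow, norm_neg, div_eq_mul_one_div]
    refine mul_le_mul (pow_le_pow_of_le_one (norm_nonneg _) hx.le (by omega)) ?_
      (norm_nonneg _) (by positivity)
    exact norm_natCast_le_of_dvd (hp.out.dvd_choose_self (by omega) (by omega))
  · have h := add_pow (-y) 1 p
    rw [← hx', Finset.sum_range_succ] at h
    have h2 : ∀ g : ℕ → ℂ_[p], ∑ i ∈ Finset.range p, g i =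
        ∑ i ∈ Finset.range q, g (i + 2) + g 1 + g 0 := fun g => by
      rw [show Finset.range p = Finset.range (q + 2) from congrArg _ hq,
        Finset.sum_range_succ', Finset.sum_range_succ']
    rw [h2] at h
    simp only [one_pow, mul_one, Nat.choose_self, Nat.cast_one, Nat.choose_one_right,
      Nat.choose_zero_right, pow_one, pow_zero, hodd.neg_pow] at h
    rw [h]
    ring

/-- With `y = 1 - x`, the terms `y^p` and `p y` compete; the next two lemmas give equality when one
of them wins strictly. -/
theorem norm_one_sub_pow_prime_le {x : ℂ_[p]} (hx : ‖1 - x‖ < 1) (hp2 : p ≠ 2) :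
    ‖1 - x ^ p‖ ≤ max (‖1 - x‖ ^ p) (‖1 - x‖ / p) := by
  obtain ⟨e, he, h⟩ := exists_one_sub_pow_prime hx hp2
  rw [h]
  refine (IsUltrametricDist.norm_add_le_max _ _).trans (max_le_max (norm_pow _ _).le ?_)
  refine (IsUltrametricDist.norm_add_le_max _ _).trans (max_le ?_ (he.trans ?_))
  · rw [norm_mul, norm_natCast_self]
    exact le_of_eq (by ring)
  · gcongr
    rw [pow_two]
    exact mul_le_of_le_one_left (norm_nonneg _) hx.le

theorem norm_one_sub_pow_prime_of_lt {x : ℂ_[p]} (hx : ‖1 - x‖ < 1) (hp2 : p ≠ 2)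
    (h : ‖1 - x‖ / p < ‖1 - x‖ ^ p) : ‖1 - x ^ p‖ = ‖1 - x‖ ^ p := by
  obtain ⟨e, he, h'⟩ := exists_one_sub_pow_prime hx hp2
  rw [h', norm_add_eq_of_norm_lt, norm_pow]
  rw [norm_pow]
  refine lt_of_le_of_lt ?_ h
  refine (IsUltrametricDist.norm_add_le_max _ _).trans (max_le ?_ (he.trans ?_))
  · rw [norm_mul, norm_natCast_self]
    exact le_of_eq (by ring)
  · gcongr
    rw [pow_two]
    exact mul_le_of_le_one_left (norm_nonneg _) hx.le

theorem norm_one_sub_pow_prime_of_gt {x : ℂ_[p]} (hx : ‖1 - x‖ < 1) (hp2 : p ≠ 2)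
    (h : ‖1 - x‖ ^ p < ‖1 - x‖ / p) : ‖1 - x ^ p‖ = ‖1 - x‖ / p := by
  obtain ⟨e, he, h'⟩ := exists_one_sub_pow_prime hx hp2
  have hp0 : (0 : ℝ) < p := by exact_mod_cast hp.out.pos
  have hx0 : 0 < ‖1 - x‖ := by
    rcases (norm_nonneg (1 - x)).eq_or_lt with h0 | h0
    · rw [← h0] at h; simp [hp.out.ne_zero] at h
    · exact h0
  have h1 : ‖(p : ℂ_[p]) * (1 - x)‖ = ‖1 - x‖ / p := by
    rw [norm_mul, norm_natCast_self]; ring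
  have h2 : ‖(p : ℂ_[p]) * (1 - x) + e‖ = ‖1 - x‖ / p := by
    rw [norm_add_eq_of_norm_lt, h1]
    rw [h1]
    refine he.trans_lt ?_
    gcongr
    rw [pow_two]
    exact mul_lt_of_lt_one_left hx0 hx
  rw [h', add_comm, norm_add_eq_of_norm_lt, h2]
  rwa [h2, norm_pow]

theorem norm_one_sub_pow_prime_le_sq {x : ℂ_[p]} (hx : ‖1 - x‖ < 1) (hp2 : p ≠ 2)
    (h : 1 / (p : ℝ) < ‖1 - x‖) : ‖1 - x ^ p‖ ≤ ‖1 - x‖ ^ 2 := by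
  refine (norm_one_sub_pow_prime_le hx hp2).trans (max_le ?_ ?_)
  · exact pow_le_pow_of_le_one (norm_nonneg _) hx.le hp.out.two_le
  · rw [pow_two, div_eq_mul_one_div]
    gcongr

theorem norm_one_sub_pow_lt_of_dvd {x : ℂ_[p]} (hx : ‖1 - x‖ < 1) (hp2 : p ≠ 2)
    (h : 1 / (p : ℝ) < ‖1 - x‖) {n : ℕ} (hn : p ∣ n) : ‖1 - x ^ n‖ < ‖1 - x‖ := by
  obtain ⟨m, rfl⟩ := hn
  have hx0 : 0 < ‖1 - x‖ := lt_of_le_of_lt (by positivity) h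
  rw [pow_mul]
  refine (norm_one_sub_pow_le ?_ m).trans_lt ((norm_one_sub_pow_prime_le_sq hx hp2 h).trans_lt ?_)
  · rw [norm_pow, norm_eq_one_of_norm_one_sub_lt hx, one_pow]
  · rw [pow_two]
    exact mul_lt_of_lt_one_left hx0 hx

end UnitPowers

-- Exact absolute values of the coefficients of the conjugacy.

section CoefficientSize

theorem coeff_one_pow {R : Type*} [CommRing R] (g : PowerSeries R) (n : ℕ) :
    PowerSeries.coeff 1 (g ^ (n + 1)) =
      (n + 1) * PowerSeries.coeff 0 g ^ n * PowerSeries.coeff 1 g := by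
  induction n with
  | zero => simp
  | succ n ih =>
    rw [pow_succ, PowerSeries.coeff_mul]
    simp only [Finset.Nat.antidiagonal_succ, Finset.Nat.antidiagonal_zero, Finset.sum_cons,
      Finset.map_singleton, Finset.sum_singleton, Function.Embedding.prodMap,
      Function.Embedding.coeFn_mk, Prod.map, Function.Embedding.refl_apply, Nat.succ_eq_add_one,
      zero_add, ih]
    simp only [PowerSeries.coeff_zero_eq_constantCoeff, map_pow]
    push_cast
    ring

/-- Doubling avoids the binomial coefficient `(n + 2).choose 2`; for odd `p` the factor `2` has norm
one. -/
theorem two_mul_coeff_two_pow {R : Type*} [CommRing R] (g : PowerSeries R) (n : ℕ) :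
    2 * PowerSeries.coeff 2 (g ^ (n + 2)) =
      2 * (n + 2) * PowerSeries.coeff 0 g ^ (n + 1) * PowerSeries.coeff 2 g +
        (n + 2) * (n + 1) * PowerSeries.coeff 0 g ^ n * PowerSeries.coeff 1 g ^ 2 := by
  have step : ∀ h : PowerSeries R, PowerSeries.coeff 2 (h * g) =
      PowerSeries.coeff 0 h * PowerSeries.coeff 2 g + PowerSeries.coeff 1 h * PowerSeries.coeff 1 g
        + PowerSeries.coeff 2 h * PowerSeries.coeff 0 g := fun h => by
    rw [PowerSeries.coeff_mul]
    simp [Finset.Nat.antidiagonal_succ, add_assoc]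
  induction n with
  | zero =>
    rw [zero_add, pow_two, step]
    push_cast
    ring
  | succ n ih =>
    rw [show n + 1 + 2 = (n + 2) + 1 by ring, pow_succ, step, coeff_one_pow]
    have : PowerSeries.coeff 0 (g ^ (n + 2)) = PowerSeries.coeff 0 g ^ (n + 2) := by simp
    rw [this]
    push_cast
    linear_combination PowerSeries.coeff 0 g * ih

variable {p : ℕ} [hp : Fact p.Prime]

/-- The norm of the coefficient of degree `n + 1` in the conjugacy to multiplication by `l`. -/
noncomputable def coeffSize (l : ℂ_[p]) : ℕ → ℝ
  | 0 => 1
  | n + 1 => coeffSize l n *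
      (if p ∣ n + 1 then ‖1 - l‖ / ‖1 - l ^ (n + 1)‖ else 1 / ‖1 - l‖)

variable {l : ℂ_[p]}

theorem coeffSize_pos (hl : ∀ n, 1 ≤ n → l ^ n ≠ 1) (n : ℕ) : 0 < coeffSize l n := by
  have h : ∀ n, 1 ≤ n → 0 < ‖1 - l ^ n‖ := fun n hn =>
    norm_pos_iff.2 (sub_ne_zero.2 (hl n hn).symm)
  have h1 := h 1 le_rfl
  rw [pow_one] at h1
  induction n with
  | zero => exact one_pos
  | succ n ih =>
    have := h (n + 1) (by omega)
    rw [coeffSize]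
    split_ifs <;> positivity

/-- Every factor exceeds one; for `p ∣ n + 1` this needs `1/p < ‖1 - l‖`. Strict growth is what
makes the late terms of the recursion dominate. -/
theorem coeffSize_strictMono (hl : ∀ n, 1 ≤ n → l ^ n ≠ 1) (hp2 : p ≠ 2)
    (hl₁ : 1 / (p : ℝ) < ‖1 - l‖) (hl₂ : ‖1 - l‖ < 1) : StrictMono (coeffSize l) := by
  refine strictMono_nat_of_lt_succ fun n => ?_
  have h0 : 0 < ‖1 - l ^ (n + 1)‖ := norm_pos_iff.2 (sub_ne_zero.2 (hl _ (by omega)).symm)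
  rw [coeffSize]
  refine lt_mul_of_one_lt_right (coeffSize_pos hl n) ?_
  split_ifs with h
  · rw [one_lt_div h0]
    exact norm_one_sub_pow_lt_of_dvd hl₂ hp2 hl₁ h
  · rw [one_lt_div (lt_of_le_of_lt (by positivity) hl₁)]
    exact hl₂

/-- The exact absolute values of the coefficients of the conjugacy. -/
theorem norm_recCoeff_eq (hp3 : 3 ≤ p) (hl₁ : 1 / (p : ℝ) < ‖1 - l‖) (hl₂ : ‖1 - l‖ < 1)
    {f : PowerSeries ℂ_[p]} (hf : f ∈ classG l) (ha₂ : ‖PowerSeries.coeff 2 f‖ = 1)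
    (ha₃ : ‖PowerSeries.coeff 2 f ^ 2 - PowerSeries.coeff 3 f‖ = 1) (n : ℕ) :
    ‖recCoeff f (fun n => l - l ^ n) (n + 1)‖ = coeffSize l n := by
  have hp2 : p ≠ 2 := by omega
  have hfb := gaussBound_of_mem_classG hf one_pos le_rfl
  obtain ⟨⟨hl1, hroot⟩, f0, f1, f2⟩ := hf
  have hmono := coeffSize_strictMono hroot hp2 hl₁ hl₂
  have hpos := coeffSize_pos hroot
  have hh : 0 < ‖1 - l‖ := lt_of_le_of_lt (by positivity) hl₁
  have hcoef : ∀ i n, ‖PowerSeries.coeff n (f ^ i)‖ ≤ 1 := fun i n => by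
    have := hfb.pow one_pos i n
    simpa using this
  obtain ⟨g, hg⟩ : PowerSeries.X ∣ f := by
    rw [PowerSeries.X_dvd_iff, ← PowerSeries.coeff_zero_eq_constantCoeff_apply, f0]
  have hgf : ∀ k, PowerSeries.coeff k g = PowerSeries.coeff (k + 1) f := fun k => by
    rw [hg, PowerSeries.coeff_succ_X_mul]
  have hfg : ∀ i k, PowerSeries.coeff (k + i) (f ^ i) = PowerSeries.coeff k (g ^ i) := fun i k => by
    rw [hg, mul_pow, PowerSeries.coeff_X_pow_mul]
  have g0 : PowerSeries.coeff 0 g = l := by rw [hgf, f1]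
  set b := recCoeff f (fun n => l - l ^ n) with hb
  induction n using Nat.strong_induction_on with
  | _ n ih =>
  rcases n with _ | n
  · rw [hb, zero_add, recCoeff_one, norm_one, coeffSize]
  rw [hb, recCoeff_of_two_le _ _ (by omega), norm_div, ← hb, coeffSize]
  have hden : ‖l - l ^ (n + 1 + 1)‖ = ‖1 - l ^ (n + 1)‖ := by
    rw [show l - l ^ (n + 1 + 1) = l * (1 - l ^ (n + 1)) by ring, norm_mul, hl1, one_mul]
  have hden0 : 0 < ‖1 - l ^ (n + 1)‖ := norm_pos_iff.2 (sub_ne_zero.2 (hroot _ (by omega)).symm)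
  -- Strict growth of the earlier coefficients bounds the tail. For `m = 0` the only term has `b 0 =
  -- 0`, so the bound is zero.
  have htail : ∀ m, m ≤ n → ‖∑ i ∈ Finset.range (m + 1),
      b i * PowerSeries.coeff (n + 1 + 1) (f ^ i)‖ < coeffSize l m := by
    intro m hm
    obtain ⟨C, hC0, hC, hC'⟩ : ∃ C : ℝ, 0 ≤ C ∧ C < coeffSize l m ∧
        ∀ i < m + 1, ‖b i‖ ≤ C := by
      rcases m with _ | m
      · refine ⟨0, le_rfl, hpos 0, fun i hi => ?_⟩
        obtain rfl : i = 0 := by omega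
        rw [hb, recCoeff_zero, norm_zero]
      · refine ⟨coeffSize l m, (hpos m).le, hmono (by omega), fun i hi => ?_⟩
        rcases i with _ | i
        · rw [hb, recCoeff_zero, norm_zero]; exact (hpos m).le
        · rw [ih i (by omega)]
          exact hmono.monotone (by omega)
    refine lt_of_le_of_lt ?_ hC
    refine IsUltrametricDist.norm_sum_le_of_forall_le_of_nonneg hC0 fun i hi => ?_
    rw [Finset.mem_range] at hi
    rw [norm_mul]
    exact (mul_le_of_le_one_right (norm_nonneg _) (hcoef i _)).trans (hC' i hi)
  have htop : PowerSeries.coeff (n + 1 + 1) (f ^ (n + 1)) =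
      ((n + 1 : ℕ) : ℂ_[p]) * l ^ n * PowerSeries.coeff 2 f := by
    rw [show n + 1 + 1 = 1 + (n + 1) by ring, hfg, coeff_one_pow, g0, hgf]
    push_cast
    ring
  have htopn : ‖PowerSeries.coeff (n + 1 + 1) (f ^ (n + 1))‖ = ‖((n + 1 : ℕ) : ℂ_[p])‖ := by
    rw [htop, norm_mul, norm_mul, norm_pow, hl1, ha₂, one_pow, mul_one, mul_one]
  rw [Finset.sum_range_succ, add_comm]
  split_ifs with hdvd
  · obtain ⟨k, rfl⟩ : ∃ k, n = k + 2 := ⟨n - 2, by have := Nat.le_of_dvd (by omega) hdvd; omega⟩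
    have hk : ¬ p ∣ k + 1 + 1 := fun h => by
      have : p ∣ 1 := (Nat.dvd_add_right h).1 hdvd
      exact hp.out.one_lt.ne' (Nat.dvd_one.1 this)
    have hsize : coeffSize l (k + 2) = coeffSize l (k + 1) / ‖1 - l‖ := by
      rw [coeffSize, if_neg hk]; ring
    have hunit : ‖PowerSeries.coeff (k + 2 + 1 + 1) (f ^ (k + 2))‖ = 1 := by
      have h2 : ‖(2 : ℂ_[p])‖ = 1 := by
        have : ¬ p ∣ 2 := fun h => by have := Nat.le_of_dvd (by omega) h; omega
        exact_mod_cast norm_natCast_of_not_dvd this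
      have e := two_mul_coeff_two_pow g k
      rw [← hfg, g0, hgf, hgf, show 2 + (k + 2) = k + 2 + 1 + 1 by ring] at e
      set N : ℂ_[p] := ((k + 2 + 1 : ℕ) : ℂ_[p]) with hN
      have hNk : (k : ℂ_[p]) = N - 3 := by rw [hN]; push_cast; ring
      have hN1 : ‖N‖ < 1 := (norm_natCast_le_of_dvd hdvd).trans_lt (hl₁.trans hl₂)
      set a := PowerSeries.coeff 2 f
      set c := PowerSeries.coeff 3 f
      have hc : ‖c‖ ≤ 1 := f2 3 (by omega)
      -- The first summand is the residue `2 (a₂² - a₃)` up to a unit power of `l`; each remaining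
      -- one carries `N` (divisible by `p`) or `1 - l`.
      have split : 2 * PowerSeries.coeff (k + 2 + 1 + 1) (f ^ (k + 2)) =
          2 * l ^ k * (a ^ 2 - c) +
            (N * (l ^ k * (2 * l * c + (N - 3) * a ^ 2)) + 2 * (1 - l) * l ^ k * c) := by
        rw [e]
        rw [hNk]
        ring
      have hmain : ‖2 * l ^ k * (a ^ 2 - c)‖ = 1 := by
        rw [norm_mul, norm_mul, h2, norm_pow, hl1, ha₃]; simp
      have hN3 : ‖N - 3‖ ≤ 1 := by
        rw [← hNk]; exact IsUltrametricDist.norm_natCast_le_one _ k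
      have hsmall : ‖N * (l ^ k * (2 * l * c + (N - 3) * a ^ 2)) + 2 * (1 - l) * l ^ k * c‖ < 1 := by
        refine (IsUltrametricDist.norm_add_le_max _ _).trans_lt (max_lt ?_ ?_)
        · rw [norm_mul]
          refine lt_of_le_of_lt (mul_le_of_le_one_right (norm_nonneg _) ?_) hN1
          rw [norm_mul, norm_pow, hl1, one_pow, one_mul]
          refine (IsUltrametricDist.norm_add_le_max _ _).trans (max_le ?_ ?_)
          · rw [norm_mul, norm_mul, h2, hl1, one_mul, one_mul]; exact hc
          · rw [norm_mul, norm_pow, ha₂, one_pow, mul_one]; exact hN3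
        · rw [norm_mul, norm_mul, norm_mul, norm_pow, h2, hl1, one_pow, mul_one, one_mul]
          exact (mul_le_of_le_one_right (norm_nonneg _) hc).trans_lt hl₂
      have := norm_add_eq_of_norm_lt (hsmall.trans_eq hmain.symm)
      rw [← split, hmain, norm_mul, h2, one_mul] at this
      exact this
    have hsub : ‖b (k + 2) * PowerSeries.coeff (k + 2 + 1 + 1) (f ^ (k + 2))‖ =
        coeffSize l (k + 1) := by
      rw [norm_mul, hunit, mul_one, ih (k + 1) (by omega)]
    -- The coefficient is larger by a factor `1/‖1 - l‖` than its predecessor, but `‖N‖ ≤ 1/p < ‖1 -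
    -- l‖` more than cancels this.
    have htopl : ‖b (k + 2 + 1) * PowerSeries.coeff (k + 2 + 1 + 1) (f ^ (k + 2 + 1))‖ <
        coeffSize l (k + 1) := by
      rw [norm_mul, htopn, ih (k + 2) (by omega), hsize, div_mul_eq_mul_div, div_lt_iff₀ hh]
      exact mul_lt_mul_of_pos_left ((norm_natCast_le_of_dvd hdvd).trans_lt hl₁) (hpos _)
    have hnum : ‖b (k + 2 + 1) * PowerSeries.coeff (k + 2 + 1 + 1) (f ^ (k + 2 + 1)) +
        ∑ i ∈ Finset.range (k + 2 + 1), b i * PowerSeries.coeff (k + 2 + 1 + 1) (f ^ i)‖ =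
        coeffSize l (k + 1) := by
      rw [Finset.sum_range_succ, add_left_comm, add_comm, add_assoc, add_comm, add_assoc,
        norm_add_eq_of_norm_lt, hsub]
      rw [hsub]
      refine (IsUltrametricDist.norm_add_le_max _ _).trans_lt (max_lt ?_ ?_)
      all_goals first | exact htopl | exact htail (k + 1) (by omega)
    rw [hnum, hden, hsize]
    field_simp
  · have htop' : ‖b (n + 1) * PowerSeries.coeff (n + 1 + 1) (f ^ (n + 1))‖ = coeffSize l n := by
      rw [norm_mul, htopn, norm_natCast_of_not_dvd hdvd, mul_one, ih n (by omega)]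
    rw [norm_add_eq_of_norm_lt (by rw [htop']; exact htail n le_rfl), htop', hden,
      norm_one_sub_pow_of_not_dvd hl₂ hdvd]
    ring

end CoefficientSize

-- The radii `R(j)`, `p`-power roots of unity, and the distance to the nearest one.

section Levels

theorem radR_zero {p : ℕ} : radR p 0 = 0 := by rw [radR, if_pos rfl]

theorem radR_succ {p : ℕ} (j : ℕ) :
    radR p (j + 1) = (p : ℝ) ^ (-(1 / ((p : ℝ) ^ j * ((p : ℝ) - 1)))) := by
  rw [radR, if_neg (by omega), Nat.add_sub_cancel]

variable {p : ℕ} [hp : Fact p.Prime]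

theorem one_lt_cast_prime : (1 : ℝ) < p := by exact_mod_cast hp.out.one_lt

theorem radR_succ_pos (j : ℕ) : 0 < radR p (j + 1) := by
  rw [radR_succ]
  exact Real.rpow_pos_of_pos (zero_lt_one.trans one_lt_cast_prime) _

theorem radR_strictMono : StrictMono (radR p) := by
  refine strictMono_nat_of_lt_succ fun j => ?_
  rcases j with _ | j
  · rw [radR_zero]; exact radR_succ_pos 0
  · have h1 : (1 : ℝ) < p := one_lt_cast_prime
    have h0 : (0 : ℝ) < p - 1 := by linarith
    rw [radR_succ, radR_succ]
    refine Real.rpow_lt_rpow_of_exponent_lt h1 ?_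
    rw [neg_lt_neg_iff]
    refine one_div_lt_one_div_of_lt (by positivity) ?_
    gcongr
    omega

theorem radR_succ_succ_pow (j : ℕ) : radR p (j + 2) ^ p = radR p (j + 1) := by
  have h1 : (1 : ℝ) < p := one_lt_cast_prime
  have h0 : (p : ℝ) - 1 ≠ 0 := by linarith
  rw [radR_succ, radR_succ, ← Real.rpow_mul_natCast (by positivity)]
  congr 1
  have : (p : ℝ) ≠ 0 := by positivity
  rw [pow_succ]
  field_simp

theorem radR_add_pow (j i : ℕ) : radR p (j + 1 + i) ^ p ^ i = radR p (j + 1) := by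
  induction i with
  | zero => simp
  | succ i ih =>
    rw [pow_succ', pow_mul, show j + 1 + (i + 1) = (j + i) + 2 by ring, radR_succ_succ_pow,
      show j + i + 1 = j + 1 + i by ring, ih]

theorem radR_one_pow : radR p 1 ^ p = radR p 1 / p := by
  have h1 : (1 : ℝ) < p := one_lt_cast_prime
  have h0 : (p : ℝ) - 1 ≠ 0 := by linarith
  have hp0 : (0 : ℝ) < p := by positivity
  rw [radR_succ, ← Real.rpow_mul_natCast hp0.le, pow_zero, one_mul, ← Real.rpow_sub_one hp0.ne']
  congr 1
  field_simp
  ring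

theorem radR_succ_lt_one (j : ℕ) : radR p (j + 1) < 1 := by
  have h1 : (1 : ℝ) < p := one_lt_cast_prime
  have h0 : (0 : ℝ) < p - 1 := by linarith
  rw [radR_succ]
  refine Real.rpow_lt_one_of_one_lt_of_neg h1 ?_
  rw [neg_lt_zero]
  positivity

theorem one_div_le_radR_one : 1 / (p : ℝ) ≤ radR p 1 := by
  have h := radR_one_pow (p := p)
  have h0 := radR_succ_pos (p := p) 0
  have h1 := (radR_succ_lt_one (p := p) 0).le
  rw [zero_add] at h0 h1
  have h2 : radR p 1 ^ p ≤ radR p 1 ^ 2 := pow_le_pow_of_le_one h0.le h1 hp.out.two_le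
  rw [h, div_eq_mul_one_div, pow_two] at h2
  exact le_of_mul_le_mul_left h2 h0

theorem tendsto_radR : Tendsto (fun j => radR p (j + 1)) atTop (𝓝 1) := by
  have h1 : (1 : ℝ) < p := one_lt_cast_prime
  have h0 : (0 : ℝ) < p - 1 := by linarith
  have : Tendsto (fun j : ℕ => -(1 / ((p : ℝ) ^ j * ((p : ℝ) - 1)))) atTop (𝓝 0) := by
    rw [← neg_zero]
    refine Tendsto.neg ?_
    simp_rw [one_div]
    exact ((tendsto_pow_atTop_atTop_of_one_lt h1).atTop_mul_const h0).inv_tendsto_atTop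
  simp_rw [radR_succ]
  have h2 := ((Real.continuous_const_rpow (a := (p : ℝ)) (by positivity)).tendsto 0).comp this
  rwa [Real.rpow_zero] at h2

theorem levelOf_spec {x : ℝ} (h0 : 0 ≤ x) (h1 : x < 1) :
    radR p (levelOf p x) ≤ x ∧ x < radR p (levelOf p x + 1) := by
  classical
  have hex : ∃ j, x < radR p (j + 1) := ((tendsto_radR (p := p)).eventually_const_lt h1).exists
  refine Nat.sInf_mem (s := {j : ℕ | radR p j ≤ x ∧ x < radR p (j + 1)})
    ⟨Nat.find hex, ?_, Nat.find_spec hex⟩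
  rcases h : Nat.find hex with _ | j
  · rw [radR_zero]; exact h0
  · exact not_lt.1 (Nat.find_min hex (by omega : j < Nat.find hex))

/-- `R(1)` is the point where `y^p` and `y/p` tie: the `p`-th power map divides distances to `1` by
`p` below it, and raises them to the power `p` above it. -/
theorem radR_one_pow_pred : radR p 1 ^ (p - 1) = 1 / p := by
  have h := radR_one_pow (p := p)
  rw [← mul_pow_sub_one hp.out.ne_zero, div_eq_mul_one_div] at h
  exact mul_left_cancel₀ (radR_succ_pos 0).ne' h

theorem div_prime_le_pow {y : ℝ} (hy : radR p 1 ≤ y) : y / p ≤ y ^ p := by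
  have h0 : 0 < radR p 1 := radR_succ_pos 0
  rw [← mul_pow_sub_one hp.out.ne_zero, div_eq_mul_one_div, ← radR_one_pow_pred]
  gcongr
  exact h0.le.trans hy

theorem div_prime_lt_pow {y : ℝ} (hy : radR p 1 < y) : y / p < y ^ p := by
  have h0 : 0 < radR p 1 := radR_succ_pos 0
  rw [← mul_pow_sub_one hp.out.ne_zero, div_eq_mul_one_div, ← radR_one_pow_pred]
  exact mul_lt_mul_of_pos_left
    (pow_lt_pow_left₀ hy h0.le (Nat.sub_ne_zero_of_lt hp.out.one_lt)) (h0.trans hy)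

theorem pow_lt_div_prime {y : ℝ} (h0 : 0 < y) (hy : y < radR p 1) : y ^ p < y / p := by
  rw [← mul_pow_sub_one hp.out.ne_zero, div_eq_mul_one_div, ← radR_one_pow_pred]
  exact mul_lt_mul_of_pos_left
    (pow_lt_pow_left₀ hy h0.le (Nat.sub_ne_zero_of_lt hp.out.one_lt)) h0

theorem norm_one_sub_pow_lt_radR_one (hp2 : p ≠ 2) {s : ℕ} {x : ℂ_[p]}
    (hx : ‖1 - x‖ < radR p (s + 1)) : ‖1 - x ^ p ^ s‖ < radR p 1 := by
  induction s generalizing x with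
  | zero => simpa using hx
  | succ s ih =>
    rw [pow_succ', pow_mul]
    have h1 : ‖1 - x‖ < 1 := hx.trans (radR_succ_lt_one _)
    refine ih ((norm_one_sub_pow_prime_le h1 hp2).trans_lt (max_lt ?_ ?_))
    · rw [← radR_succ_succ_pow s]
      exact pow_lt_pow_left₀ hx (norm_nonneg _) hp.out.ne_zero
    · calc ‖1 - x‖ / p < 1 / p := by
            have : (0 : ℝ) < p := by exact_mod_cast hp.out.pos
            gcongr
        _ ≤ radR p 1 := one_div_le_radR_one
        _ ≤ radR p (s + 1) := radR_strictMono.monotone (by omega)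

theorem norm_one_sub_pow_of_lt_radR_one (hp2 : p ≠ 2) {x : ℂ_[p]} (hx : ‖1 - x‖ < radR p 1)
    (i : ℕ) : ‖1 - x ^ p ^ i‖ = ‖1 - x‖ / p ^ i := by
  rcases eq_or_ne x 1 with rfl | hne
  · simp
  have h0 : 0 < ‖1 - x‖ := norm_pos_iff.2 (sub_ne_zero.2 hne.symm)
  have hp0 : (0 : ℝ) < p := by exact_mod_cast hp.out.pos
  have h1p : (1 : ℝ) ≤ p := one_lt_cast_prime.le
  induction i with
  | zero => simp
  | succ i ih =>
    have hlt : ‖1 - x ^ p ^ i‖ < radR p 1 := by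
      rw [ih]
      exact (div_le_self h0.le (one_le_pow₀ h1p)).trans_lt hx
    rw [pow_succ, pow_mul, norm_one_sub_pow_prime_of_gt (hlt.trans (radR_succ_lt_one 0)) hp2,
      ih, pow_succ, div_div]
    exact pow_lt_div_prime (by rw [ih]; positivity) hlt

theorem radR_le_pow {s i : ℕ} (hi : i < s) {y : ℝ} (hy : radR p s ≤ y) :
    radR p (s - i) ≤ y ^ p ^ i := by
  obtain ⟨j, rfl⟩ : ∃ j, s = j + 1 + i := ⟨s - i - 1, by omega⟩
  rw [show j + 1 + i - i = j + 1 by omega, ← radR_add_pow j i]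
  have : 0 ≤ radR p (j + 1 + i) := by
    rw [show j + 1 + i = j + i + 1 by ring]; exact (radR_succ_pos _).le
  gcongr

theorem norm_one_sub_pow_of_radR_le (hp2 : p ≠ 2) {s i : ℕ} (hi : i < s) {x : ℂ_[p]}
    (hx1 : ‖1 - x‖ < 1) (hx : radR p s ≤ ‖1 - x‖) : ‖1 - x ^ p ^ i‖ = ‖1 - x‖ ^ p ^ i := by
  induction i with
  | zero => simp
  | succ i ih =>
    have e := ih (by omega)
    have hgt : radR p 1 < ‖1 - x ^ p ^ i‖ := by
      rw [e]
      exact (radR_strictMono (by omega)).trans_le (radR_le_pow (by omega) hx)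
    have hlt : ‖1 - x ^ p ^ i‖ < 1 := by
      rw [e]; exact pow_lt_one₀ (norm_nonneg _) hx1 (pow_ne_zero _ hp.out.ne_zero)
    rw [pow_succ, pow_mul, norm_one_sub_pow_prime_of_lt hlt hp2 (div_prime_lt_pow hgt), e, pow_mul]

/-- Unlike the preceding equality, this allows `i = s`. The last step may then start exactly at
`R(1)`, where the two competing terms can cancel, so only an inequality survives. -/
theorem norm_one_sub_pow_le_of_radR_le (hp2 : p ≠ 2) {s i : ℕ} (hi : i ≤ s) {x : ℂ_[p]}
    (hx1 : ‖1 - x‖ < 1) (hx : radR p s ≤ ‖1 - x‖) : ‖1 - x ^ p ^ i‖ ≤ ‖1 - x‖ ^ p ^ i := by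
  induction i with
  | zero => simp
  | succ i ih =>
    have e := ih (by omega)
    have hge : radR p 1 ≤ ‖1 - x‖ ^ p ^ i :=
      (radR_strictMono.monotone (by omega)).trans (radR_le_pow (by omega) hx)
    have hlt : ‖1 - x ^ p ^ i‖ < 1 :=
      e.trans_lt (pow_lt_one₀ (norm_nonneg _) hx1 (pow_ne_zero _ hp.out.ne_zero))
    rw [pow_succ, pow_mul, pow_mul]
    refine (norm_one_sub_pow_prime_le hlt hp2).trans (max_le ?_ ?_)
    · gcongr
    · refine le_trans ?_ (div_prime_le_pow hge)
      gcongr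

/-- Up to sign, `1 - x^n` is the product of `x - ζ` over the `n`-th roots of unity. -/
theorem pow_le_norm_one_sub_pow {δ : ℝ} (hδ : 0 ≤ δ) {x : ℂ_[p]} {n : ℕ} (hn : n ≠ 0)
    (h : ∀ ζ : ℂ_[p], ζ ^ n = 1 → δ ≤ ‖x - ζ‖) : δ ^ n ≤ ‖1 - x ^ n‖ := by
  have hmonic := Polynomial.monic_X_pow_sub_C (1 : ℂ_[p]) hn
  have hs := IsAlgClosed.splits (Polynomial.X ^ n - Polynomial.C (1 : ℂ_[p]))
  have e := hs.eval_eq_prod_roots x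
  rw [hmonic.leadingCoeff, one_mul, Polynomial.eval_sub, Polynomial.eval_pow, Polynomial.eval_X,
    Polynomial.eval_C] at e
  have hcard := hs.natDegree_eq_card_roots
  rw [Polynomial.natDegree_X_pow_sub_C] at hcard
  have hroots : ∀ ζ ∈ (Polynomial.X ^ n - Polynomial.C (1 : ℂ_[p])).roots, ζ ^ n = 1 := by
    intro ζ hζ
    rw [Polynomial.mem_roots hmonic.ne_zero, Polynomial.IsRoot.def, Polynomial.eval_sub,
      Polynomial.eval_pow, Polynomial.eval_X, Polynomial.eval_C] at hζ
    exact sub_eq_zero.1 hζ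
  rw [← norm_neg, neg_sub, e]
  conv_lhs => rw [hcard]
  generalize (Polynomial.X ^ n - Polynomial.C (1 : ℂ_[p])).roots = S at hroots
  clear hcard e hs
  induction S using Multiset.induction_on with
  | empty => simp
  | cons a S ih =>
    rw [Multiset.card_cons, Multiset.map_cons, Multiset.prod_cons, norm_mul, pow_succ']
    exact mul_le_mul (h a (hroots a (Multiset.mem_cons_self a S)))
      (ih fun ζ hζ => hroots ζ (Multiset.mem_cons_of_mem hζ)) (by positivity) (norm_nonneg _)

/-- The power `ζ^(p^s)` lies within `R(1)` of `1`, where each further `p`-th power only divides the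
distance by `p`; it can reach `1` only if it is already there. -/
theorem pow_eq_one_of_norm_one_sub_lt (hp2 : p ≠ 2) {ζ : ℂ_[p]} (hζ : ζ ∈ gammaR p) {s : ℕ}
    (h : ‖1 - ζ‖ < radR p (s + 1)) : ζ ^ p ^ s = 1 := by
  obtain ⟨k, hk⟩ := hζ
  have h1 := norm_one_sub_pow_lt_radR_one hp2 h
  have h2 := norm_one_sub_pow_of_lt_radR_one hp2 h1 k
  rw [← pow_mul, mul_comm, pow_mul, hk, one_pow, sub_self, norm_zero, eq_comm, div_eq_zero_iff] at h2
  rcases h2 with h2 | h2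
  · exact (sub_eq_zero.1 (norm_eq_zero.1 h2)).symm
  · exact absurd h2 (pow_ne_zero _ (by exact_mod_cast hp.out.ne_zero))

theorem mOf_eq_one {l : ℂ_[p]} (hl₂ : ‖1 - l‖ < 1) : mOf l = 1 := by
  have h : 1 ∈ {n : ℕ | 1 ≤ n ∧ ‖1 - l ^ n‖ < 1} := ⟨le_rfl, by rwa [pow_one]⟩
  exact le_antisymm (Nat.sInf_le h) (Nat.sInf_mem ⟨1, h⟩).1

/-- The minimum is attained because any `ζ` at least as close to `l` as `1` is lies within `R(s+1)`
of `1`, leaving the finitely many `p^s`-th roots of unity. -/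
theorem gammaZero_spec (hp2 : p ≠ 2) {l : ℂ_[p]} (hl₂ : ‖1 - l‖ < 1) :
    gammaZero l ∈ gammaR p ∧ ∀ ζ ∈ gammaR p, ‖gammaZero l - l‖ ≤ ‖ζ - l‖ := by
  have key : ∃ γ : ℂ_[p], γ ∈ gammaR p ∧ ∀ ζ ∈ gammaR p, ‖γ - l ^ mOf l‖ ≤ ‖ζ - l ^ mOf l‖ := by
    rw [mOf_eq_one hl₂, pow_one]
    obtain ⟨s, hs⟩ : ∃ s, ‖1 - l‖ < radR p (s + 1) :=
      ⟨_, (levelOf_spec (norm_nonneg _) hl₂).2⟩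
    have hn : 0 < p ^ s := pow_pos hp.out.pos s
    obtain ⟨γ, hγ, hmin⟩ := (Polynomial.nthRootsFinset (p ^ s) (1 : ℂ_[p])).exists_min_image
      (fun ζ => ‖ζ - l‖) ⟨1, by rw [Polynomial.mem_nthRootsFinset hn]; simp⟩
    rw [Polynomial.mem_nthRootsFinset hn] at hγ
    refine ⟨γ, ⟨s, hγ⟩, fun ζ hζ => ?_⟩
    rcases le_or_gt ‖ζ - l‖ ‖1 - l‖ with h | h
    · refine hmin ζ ((Polynomial.mem_nthRootsFinset hn 1).2
        (pow_eq_one_of_norm_one_sub_lt hp2 hζ (lt_of_le_of_lt ?_ hs)))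
      rw [show 1 - ζ = (1 - l) + -(ζ - l) by ring]
      refine (IsUltrametricDist.norm_add_le_max _ _).trans (max_le le_rfl ?_)
      rwa [norm_neg]
    · exact (hmin 1 (by rw [Polynomial.mem_nthRootsFinset hn]; simp)).trans h.le
  have := Classical.epsilon_spec key
  rw [← gammaZero.eq_def l] at this
  rwa [mOf_eq_one hl₂, pow_one] at this

theorem sOf_spec {l : ℂ_[p]} (hl₂ : ‖1 - l‖ < 1) :
    radR p (sOf l) ≤ ‖1 - l‖ ∧ ‖1 - l‖ < radR p (sOf l + 1) := by
  have := levelOf_spec (p := p) (norm_nonneg _) hl₂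
  rwa [sOf, mOf_eq_one hl₂, pow_one]

theorem norm_gammaZero_sub_le (hp2 : p ≠ 2) {l : ℂ_[p]} (hl₂ : ‖1 - l‖ < 1) :
    ‖gammaZero l - l‖ ≤ ‖1 - l‖ := (gammaZero_spec hp2 hl₂).2 1 ⟨0, by simp⟩

theorem tOf_spec (hp2 : p ≠ 2) {l : ℂ_[p]} (hl₂ : ‖1 - l‖ < 1) :
    radR p (tOf l) ≤ ‖gammaZero l - l‖ ∧ ‖gammaZero l - l‖ < radR p (tOf l + 1) := by
  have := levelOf_spec (p := p) (norm_nonneg _) ((norm_gammaZero_sub_le hp2 hl₂).trans_lt hl₂)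
  rwa [tOf, mOf_eq_one hl₂, pow_one]

theorem tOf_le_sOf (hp2 : p ≠ 2) {l : ℂ_[p]} (hl₂ : ‖1 - l‖ < 1) : tOf l ≤ sOf l := by
  have h := ((tOf_spec hp2 hl₂).1.trans (norm_gammaZero_sub_le hp2 hl₂)).trans_lt (sOf_spec hl₂).2
  have := radR_strictMono.lt_iff_lt.1 h
  omega

/-- The size of `1 - l^(p^s)` in terms of the distance from `l` to the roots of unity. -/
theorem norm_one_sub_pow_sOf (hp2 : p ≠ 2) {l : ℂ_[p]} (hl₂ : ‖1 - l‖ < 1) :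
    ‖1 - l ^ p ^ sOf l‖ = ‖gammaZero l - l‖ ^ p ^ tOf l / p ^ (sOf l - tOf l) := by
  obtain ⟨hγ, hmin⟩ := gammaZero_spec hp2 hl₂
  obtain ⟨t1, t2⟩ := tOf_spec hp2 hl₂
  have hle := norm_gammaZero_sub_le hp2 hl₂
  have hts := tOf_le_sOf hp2 hl₂
  set γ := gammaZero l
  set δ := ‖γ - l‖ with hδ
  have h1γ : ‖1 - γ‖ ≤ ‖1 - l‖ := by
    rw [show 1 - γ = (1 - l) + -(γ - l) by ring]
    refine (IsUltrametricDist.norm_add_le_max _ _).trans (max_le le_rfl ?_)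
    rwa [norm_neg]
  have hγs : γ ^ p ^ sOf l = 1 :=
    pow_eq_one_of_norm_one_sub_lt hp2 hγ (h1γ.trans_lt (sOf_spec hl₂).2)
  have hγ1 : ‖γ‖ = 1 := norm_eq_one_of_norm_one_sub_lt (h1γ.trans_lt hl₂)
  have hγ0 : γ ≠ 0 := norm_pos_iff.1 (by rw [hγ1]; exact one_pos)
  -- Dividing by `γ` leaves `1 - l^(p^s)` unchanged and makes `1` a nearest root of unity.
  set μ := l / γ with hμ
  have hdist : ∀ ζ : ℂ_[p], ‖μ - ζ‖ = ‖ζ * γ - l‖ := fun ζ => by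
    rw [← norm_neg, show ζ * γ - l = -(μ - ζ) * γ by rw [hμ]; field_simp; ring, norm_mul, hγ1,
      mul_one]
  have hμ1 : ‖1 - μ‖ = δ := by rw [← norm_neg, neg_sub, hdist, one_mul]
  have hμlt : ‖1 - μ‖ < 1 := by rw [hμ1]; exact hle.trans_lt hl₂
  have hpow : ‖1 - l ^ p ^ sOf l‖ = ‖1 - μ ^ p ^ sOf l‖ := by
    rw [hμ, div_pow, hγs, div_one]
  have ht : ‖1 - μ ^ p ^ tOf l‖ = δ ^ p ^ tOf l := by
    refine le_antisymm ?_ ?_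
    · rw [← hμ1]
      exact norm_one_sub_pow_le_of_radR_le hp2 le_rfl hμlt (by rw [hμ1]; exact t1)
    -- Minimality of `γ` keeps `μ` at distance at least `δ` from every root, which settles the tie
    -- `δ = R(t)` as well.
    · refine pow_le_norm_one_sub_pow (norm_nonneg _) (pow_ne_zero _ hp.out.ne_zero) fun ζ hζ => ?_
      rw [hdist]
      obtain ⟨k, hk⟩ := hγ
      refine hmin _ ⟨tOf l + k, ?_⟩
      rw [mul_pow, pow_add, pow_mul, hζ, one_pow, mul_comm (p ^ tOf l), pow_mul, hk, one_pow,
        one_mul]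
  have hlt : ‖1 - μ ^ p ^ tOf l‖ < radR p 1 :=
    norm_one_sub_pow_lt_radR_one hp2 (by rw [hμ1]; exact t2)
  have := norm_one_sub_pow_of_lt_radR_one hp2 hlt (sOf l - tOf l)
  rw [← pow_mul, ← pow_add, Nat.add_sub_cancel' hts, ht] at this
  rw [hpow, this]

end Levels

-- Growth rate of the coefficients and the value of the radius.

section Radius

variable {p : ℕ} [hp : Fact p.Prime] {l : ℂ_[p]}

/-- The valuation of `1 - l^(p^i)`, in natural logarithmic units. -/
noncomputable def unitVal (l : ℂ_[p]) (i : ℕ) : ℝ := -Real.log ‖1 - l ^ p ^ i‖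

theorem norm_one_sub_pow_pos (hl : ∀ n, 1 ≤ n → l ^ n ≠ 1) (i : ℕ) : 0 < ‖1 - l ^ p ^ i‖ :=
  norm_pos_iff.2 (sub_ne_zero.2 (hl _ (pow_pos hp.out.pos i)).symm)

theorem norm_one_sub_pow_lt_one (hl₂ : ‖1 - l‖ < 1) (n : ℕ) : ‖1 - l ^ n‖ < 1 :=
  (norm_one_sub_pow_le (norm_eq_one_of_norm_one_sub_lt hl₂).le n).trans_lt hl₂

theorem unitVal_zero : unitVal l 0 = -Real.log ‖1 - l‖ := by rw [unitVal, pow_zero, pow_one]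

theorem unitVal_le_succ (hl : ∀ n, 1 ≤ n → l ^ n ≠ 1) (hl₂ : ‖1 - l‖ < 1) (i : ℕ) :
    unitVal l i ≤ unitVal l (i + 1) := by
  refine neg_le_neg (Real.log_le_log (norm_one_sub_pow_pos hl _) ?_)
  rw [pow_succ, pow_mul]
  exact norm_one_sub_pow_le
    (norm_eq_one_of_norm_one_sub_lt (norm_one_sub_pow_lt_one hl₂ _)).le p

theorem two_mul_unitVal_zero_le (hp2 : p ≠ 2) (hl : ∀ n, 1 ≤ n → l ^ n ≠ 1)
    (hl₁ : 1 / (p : ℝ) < ‖1 - l‖) (hl₂ : ‖1 - l‖ < 1) : 2 * unitVal l 0 ≤ unitVal l 1 := by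
  have h0 := norm_one_sub_pow_pos hl 1
  rw [pow_one] at h0
  have h := Real.log_le_log h0 (norm_one_sub_pow_prime_le_sq hl₂ hp2 hl₁)
  rw [Real.log_pow] at h
  rw [unitVal_zero, unitVal, pow_one]
  push_cast at h
  linarith

theorem unitVal_of_lt_sOf (hp2 : p ≠ 2) (hl₂ : ‖1 - l‖ < 1) {i : ℕ} (hi : i < sOf l) :
    unitVal l i = p ^ i * unitVal l 0 := by
  rw [unitVal_zero, unitVal, norm_one_sub_pow_of_radR_le hp2 hi hl₂ (sOf_spec hl₂).1, Real.log_pow]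
  push_cast
  ring

theorem unitVal_sOf_add (hp2 : p ≠ 2) (hl : ∀ n, 1 ≤ n → l ^ n ≠ 1) (hl₂ : ‖1 - l‖ < 1) (j : ℕ) :
    unitVal l (sOf l + j) = unitVal l (sOf l) + j * Real.log p := by
  have hp0 : (p : ℝ) ≠ 0 := by exact_mod_cast hp.out.ne_zero
  have h := norm_one_sub_pow_of_lt_radR_one hp2
    (norm_one_sub_pow_lt_radR_one hp2 (sOf_spec hl₂).2) j
  rw [← pow_mul, ← pow_add] at h
  rw [unitVal, unitVal, h, Real.log_div (norm_one_sub_pow_pos hl _).ne' (pow_ne_zero _ hp0),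
    Real.log_pow]
  ring

/-- Passing from `n` to `n + 1` raises `⌊n/p^i⌋` by one exactly when `p^i ∣ n + 1`, so the
differences of `unitVal` telescope to the valuation of `1 - l^(n+1)`. The bound on `n` makes all
later floors vanish. -/
theorem log_coeffSize (hl : ∀ n, 1 ≤ n → l ^ n ≠ 1) (hl₂ : ‖1 - l‖ < 1) (K n : ℕ)
    (hn : n < p ^ (K + 1)) :
    Real.log (coeffSize l n) = n * unitVal l 0 - unitVal l 0 * (n / p : ℕ) +
      ∑ i ∈ Finset.range K, (unitVal l (i + 1) - unitVal l i) * (n / p ^ (i + 1) : ℕ) := by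
  induction n with
  | zero => simp [coeffSize]
  | succ n ih =>
    obtain ⟨v, m, hm, hvm⟩ := Nat.exists_eq_pow_mul_and_not_dvd (Nat.succ_ne_zero n) p hp.out.ne_one
    rw [Nat.succ_eq_add_one] at hvm
    have hdvd : ∀ i, p ^ i ∣ n + 1 ↔ i ≤ v := fun i => by
      refine ⟨fun h => ?_, fun h => ?_⟩
      · by_contra! hlt
        have h2 := (pow_dvd_pow p (Nat.succ_le_of_lt hlt)).trans h
        rw [hvm, pow_succ, Nat.mul_dvd_mul_iff_left (pow_pos hp.out.pos v)] at h2
        exact hm h2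
      · exact (pow_dvd_pow p h).trans (hvm ▸ dvd_mul_right _ _)
    have hvK : v ≤ K := by
      have h1 : p ^ v ≤ n + 1 := Nat.le_of_dvd (by omega) ((hdvd v).2 le_rfl)
      have := (Nat.pow_lt_pow_iff_right hp.out.one_lt).1 (h1.trans_lt hn)
      omega
    have hval : -Real.log ‖1 - l ^ (n + 1)‖ = unitVal l v := by
      rw [unitVal, hvm, pow_mul, norm_one_sub_pow_of_not_dvd (norm_one_sub_pow_lt_one hl₂ _) hm]
    have hpos : 0 < ‖1 - l ^ (n + 1)‖ := norm_pos_iff.2 (sub_ne_zero.2 (hl _ (by omega)).symm)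
    have h0pos : 0 < ‖1 - l‖ := by simpa using norm_one_sub_pow_pos hl 0
    have hp1 : p ∣ n + 1 ↔ 1 ≤ v := by simpa using hdvd 1
    have hsum : ∑ i ∈ Finset.range K, (unitVal l (i + 1) - unitVal l i) *
        ((n + 1) / p ^ (i + 1) : ℕ) =
        ∑ i ∈ Finset.range K, (unitVal l (i + 1) - unitVal l i) * (n / p ^ (i + 1) : ℕ) +
          (unitVal l v - unitVal l 0) := by
      have hv : unitVal l v - unitVal l 0 = ∑ i ∈ Finset.range K,
          if i < v then unitVal l (i + 1) - unitVal l i else 0 := by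
        rw [← Finset.sum_range_sub (unitVal l) v,
          ← Finset.sum_subset (Finset.range_subset_range.2 hvK)
            (fun i _ hi => if_neg (by simpa using hi))]
        exact Finset.sum_congr rfl fun i hi => (if_pos (Finset.mem_range.1 hi)).symm
      rw [hv, ← Finset.sum_add_distrib]
      refine Finset.sum_congr rfl fun i _ => ?_
      rw [Nat.succ_div]
      simp only [hdvd, Nat.succ_le_iff]
      split_ifs <;> push_cast <;> ring
    rw [coeffSize, Real.log_mul (coeffSize_pos hl n).ne' (by split_ifs <;> positivity),
      ih (by omega), hsum, Nat.succ_div]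
    by_cases h : 1 ≤ v
    · rw [if_pos (hp1.2 h), if_pos (hp1.2 h), Real.log_div h0pos.ne' hpos.ne', ← hval,
        unitVal_zero]
      push_cast
      ring
    · obtain rfl : v = 0 := by omega
      rw [if_neg (mt hp1.1 h), if_neg (mt hp1.1 h), Real.log_div one_ne_zero h0pos.ne',
        Real.log_one, unitVal_zero]
      push_cast
      ring

/-- The growth rate of `coeffSize` along `p^K`. -/
noncomputable def coeffSlope (l : ℂ_[p]) (K : ℕ) : ℝ :=
  unitVal l 0 - unitVal l 0 / p +
    ∑ i ∈ Finset.range K, (unitVal l (i + 1) - unitVal l i) / (p : ℝ) ^ (i + 1)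

theorem log_coeffSize_le (hp2 : p ≠ 2) (hl : ∀ n, 1 ≤ n → l ^ n ≠ 1)
    (hl₁ : 1 / (p : ℝ) < ‖1 - l‖) (hl₂ : ‖1 - l‖ < 1) (K n : ℕ) (hn : n < p ^ (K + 2)) :
    Real.log (coeffSize l n) ≤ n * coeffSlope l (K + 1) := by
  rw [log_coeffSize hl hl₂ (K + 1) n hn, coeffSlope, Finset.sum_range_succ', Finset.sum_range_succ']
  have h0 := two_mul_unitVal_zero_le hp2 hl hl₁ hl₂
  have hfloor : ∀ i : ℕ, ((n / p ^ i : ℕ) : ℝ) ≤ n / (p : ℝ) ^ i := fun i => by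
    have := Nat.cast_div_le (α := ℝ) (m := n) (n := p ^ i)
    rwa [Nat.cast_pow] at this
  have h1 : ∑ i ∈ Finset.range K, (unitVal l (i + 1 + 1) - unitVal l (i + 1)) *
        (n / p ^ (i + 1 + 1) : ℕ) ≤
      n * ∑ i ∈ Finset.range K, (unitVal l (i + 1 + 1) - unitVal l (i + 1)) /
        (p : ℝ) ^ (i + 1 + 1) := by
    rw [Finset.mul_sum]
    refine Finset.sum_le_sum fun i _ => ?_
    calc _ ≤ (unitVal l (i + 1 + 1) - unitVal l (i + 1)) * (n / (p : ℝ) ^ (i + 1 + 1)) :=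
          mul_le_mul_of_nonneg_left (hfloor _) (sub_nonneg.2 (unitVal_le_succ hl hl₂ _))
      _ = _ := by ring
  -- The floor `⌊n/p⌋` has total coefficient `v₁ - 2 v₀`, where `vᵢ = unitVal l i`. This is the only
  -- one whose sign is in doubt, and `1/p < ‖1 - l‖` makes it nonnegative.
  have h2 : (unitVal l 1 - 2 * unitVal l 0) * (n / p : ℕ) ≤
      (unitVal l 1 - 2 * unitVal l 0) * (n / (p : ℝ)) := by
    have := hfloor 1
    rw [pow_one, pow_one] at this
    exact mul_le_mul_of_nonneg_left this (sub_nonneg.2 h0)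
  simp only [zero_add, pow_one] at *
  have e : (n : ℝ) * (unitVal l 0 - unitVal l 0 / p +
      (∑ i ∈ Finset.range K, (unitVal l (i + 1 + 1) - unitVal l (i + 1)) /
        (p : ℝ) ^ (i + 1 + 1) + (unitVal l 1 - unitVal l 0) / p)) =
      n * unitVal l 0 + (n * ∑ i ∈ Finset.range K, (unitVal l (i + 1 + 1) - unitVal l (i + 1)) /
        (p : ℝ) ^ (i + 1 + 1)) + (unitVal l 1 - 2 * unitVal l 0) * (n / (p : ℝ)) := by ring
  rw [e]
  linarith

/-- At `n = p^K` all the floors are exact, so the linear bound is attained. -/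
theorem log_coeffSize_prime_pow (hl : ∀ n, 1 ≤ n → l ^ n ≠ 1) (hl₂ : ‖1 - l‖ < 1) {K : ℕ}
    (hK : 1 ≤ K) : Real.log (coeffSize l (p ^ K)) = p ^ K * coeffSlope l K := by
  have hp0 : (p : ℝ) ≠ 0 := by exact_mod_cast hp.out.ne_zero
  have hdiv : ∀ i, i ≤ K → ((p ^ K / p ^ i : ℕ) : ℝ) = p ^ K / (p : ℝ) ^ i := fun i hi => by
    rw [Nat.cast_div (pow_dvd_pow p hi) (by exact_mod_cast pow_ne_zero i hp.out.ne_zero)]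
    push_cast
    rfl
  have h1 := hdiv 1 hK
  rw [pow_one, pow_one] at h1
  rw [log_coeffSize hl hl₂ K _ (Nat.pow_lt_pow_right hp.out.one_lt (by omega)), coeffSlope, h1,
    mul_add,
    Finset.mul_sum]
  congr 1
  · push_cast
    ring
  · refine Finset.sum_congr rfl fun i hi => ?_
    rw [hdiv (i + 1) (Finset.mem_range.1 hi)]
    ring

theorem coeffSlope_of_le_sOf (hp2 : p ≠ 2) (hl₂ : ‖1 - l‖ < 1) {K : ℕ} (hK : K ≤ sOf l) :
    coeffSlope l K = unitVal l 0 * (K * ((p - 1) / p) - 1 / p) + unitVal l K / (p : ℝ) ^ K := by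
  have hp0 : (p : ℝ) ≠ 0 := by exact_mod_cast hp.out.ne_zero
  induction K with
  | zero => simp [coeffSlope]; ring
  | succ K ih =>
    have e : coeffSlope l (K + 1) =
        coeffSlope l K + (unitVal l (K + 1) - unitVal l K) / (p : ℝ) ^ (K + 1) := by
      rw [coeffSlope, Finset.sum_range_succ, ← add_assoc, coeffSlope]
    rw [e, ih (by omega), unitVal_of_lt_sOf hp2 hl₂ hK, pow_succ]
    push_cast
    field_simp
    ring

/-- From level `s` on, `unitVal` grows by `log p` per step, so the increments of the slope form a
geometric series. -/
theorem coeffSlope_sOf_add (hp2 : p ≠ 2) (hl : ∀ n, 1 ≤ n → l ^ n ≠ 1) (hl₂ : ‖1 - l‖ < 1) (j : ℕ) :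
    coeffSlope l (sOf l + j) = coeffSlope l (sOf l) + Real.log p / ((p - 1) * (p : ℝ) ^ sOf l) -
      Real.log p / ((p - 1) * (p : ℝ) ^ (sOf l + j)) := by
  have hp0 : (p : ℝ) ≠ 0 := by exact_mod_cast hp.out.ne_zero
  have hp1 : (p : ℝ) - 1 ≠ 0 := by have := one_lt_cast_prime (p := p); linarith
  induction j with
  | zero => simp
  | succ j ih =>
    have e : coeffSlope l (sOf l + (j + 1)) = coeffSlope l (sOf l + j) +
        (unitVal l (sOf l + (j + 1)) - unitVal l (sOf l + j)) / (p : ℝ) ^ (sOf l + j + 1) := by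
      rw [← add_assoc, coeffSlope, Finset.sum_range_succ, ← add_assoc, coeffSlope]
    rw [e, ih, unitVal_sOf_add hp2 hl hl₂, unitVal_sOf_add hp2 hl hl₂, ← add_assoc, pow_succ]
    push_cast
    field_simp
    ring

theorem norm_gammaZero_sub_pos (hp2 : p ≠ 2) (hl : ∀ n, 1 ≤ n → l ^ n ≠ 1) (hl₂ : ‖1 - l‖ < 1) :
    0 < ‖gammaZero l - l‖ := by
  refine norm_pos_iff.2 (sub_ne_zero.2 fun h => ?_)
  obtain ⟨⟨k, hk⟩, -⟩ := gammaZero_spec hp2 hl₂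
  rw [h] at hk
  exact hl _ (pow_pos hp.out.pos k) hk

theorem radius_pos (hp2 : p ≠ 2) (hl : ∀ n, 1 ≤ n → l ^ n ≠ 1) (hl₂ : ‖1 - l‖ < 1) :
    0 < ‖1 - l‖ ^ (-(1 / (p : ℝ))) * rTilde l := by
  have h0 : 0 < ‖1 - l‖ := by simpa using norm_one_sub_pow_pos hl 0
  have hδ := norm_gammaZero_sub_pos hp2 hl hl₂
  have hR := radR_succ_pos (p := p) (sOf l)
  have hp0 : (0 : ℝ) < p := by exact_mod_cast hp.out.pos
  rw [rTilde, mOf_eq_one hl₂, pow_one]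
  positivity

/-- The right side is minus the limit of `coeffSlope l K` as `K` grows. -/
theorem log_radius (hp2 : p ≠ 2) (hl : ∀ n, 1 ≤ n → l ^ n ≠ 1) (hl₂ : ‖1 - l‖ < 1) :
    Real.log (‖1 - l‖ ^ (-(1 / (p : ℝ))) * rTilde l) =
      -(coeffSlope l (sOf l) + Real.log p / ((p - 1) * (p : ℝ) ^ sOf l)) := by
  have h0 : 0 < ‖1 - l‖ := by simpa using norm_one_sub_pow_pos hl 0
  have hδ := norm_gammaZero_sub_pos hp2 hl hl₂
  have hR := radR_succ_pos (p := p) (sOf l)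
  have hp0 : (0 : ℝ) < p := by exact_mod_cast hp.out.pos
  have hp1 : (p : ℝ) - 1 ≠ 0 := by have := one_lt_cast_prime (p := p); linarith
  have hs : unitVal l (sOf l) = -((p : ℝ) ^ tOf l * Real.log ‖gammaZero l - l‖) +
      ((sOf l : ℝ) - tOf l) * Real.log p := by
    rw [unitVal, norm_one_sub_pow_sOf hp2 hl₂, Real.log_div (by positivity) (by positivity),
      Real.log_pow, Real.log_pow, Nat.cast_sub (tOf_le_sOf hp2 hl₂)]
    push_cast
    ring
  rw [rTilde, mOf_eq_one hl₂, pow_one, Nat.cast_one, div_one, Real.rpow_one,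
    Real.log_mul (by positivity) (by positivity), Real.log_mul (by positivity) (by positivity),
    Real.log_mul (by positivity) (by positivity), Real.log_mul (by positivity) (by positivity),
    radR_succ, Real.log_rpow h0, Real.log_rpow hp0, Real.log_rpow hp0, Real.log_rpow h0,
    Real.log_rpow hδ, coeffSlope_of_le_sOf hp2 hl₂ le_rfl, hs, unitVal_zero, zpow_sub₀ hp0.ne',
    zpow_natCast, zpow_natCast]
  field_simp
  ring

theorem coeffSize_mul_radius_pow_le (hp2 : p ≠ 2) (hl : ∀ n, 1 ≤ n → l ^ n ≠ 1)
    (hl₁ : 1 / (p : ℝ) < ‖1 - l‖) (hl₂ : ‖1 - l‖ < 1) (n : ℕ) :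
    coeffSize l n * (‖1 - l‖ ^ (-(1 / (p : ℝ))) * rTilde l) ^ n ≤ 1 := by
  have hr := radius_pos hp2 hl hl₂
  have hc := coeffSize_pos hl n
  have hp1 : (1 : ℝ) < p := one_lt_cast_prime
  have hp1' : (0 : ℝ) < p - 1 := by linarith
  rw [← Real.log_nonpos_iff (by positivity), Real.log_mul (by positivity) (by positivity),
    Real.log_pow, log_radius hp2 hl hl₂]
  -- Any sufficiently large level will do; `n < p^n` makes this one large enough.
  have h := log_coeffSize_le hp2 hl hl₁ hl₂ (sOf l + n) n
    ((Nat.lt_pow_self hp.out.one_lt).trans_le (Nat.pow_le_pow_right hp.out.pos (by omega)))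
  rw [add_assoc, coeffSlope_sOf_add hp2 hl hl₂] at h
  have hpos : 0 ≤ (n : ℝ) * (Real.log p / ((p - 1) * (p : ℝ) ^ (sOf l + (n + 1)))) := by
    have := Real.log_pos hp1
    positivity
  linarith

/-- The slope at level `K` misses its limit by `log p / ((p - 1) p^K)`; multiplying by `p^K` leaves
a constant independent of `K`. -/
theorem coeffSize_mul_radius_pow_prime_pow (hp2 : p ≠ 2) (hl : ∀ n, 1 ≤ n → l ^ n ≠ 1)
    (hl₂ : ‖1 - l‖ < 1) (j : ℕ) :
    coeffSize l (p ^ (sOf l + (j + 1))) *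
      (‖1 - l‖ ^ (-(1 / (p : ℝ))) * rTilde l) ^ p ^ (sOf l + (j + 1)) =
      Real.exp (-(Real.log p / (p - 1))) := by
  have hr := radius_pos hp2 hl hl₂
  have hc := coeffSize_pos hl (p ^ (sOf l + (j + 1)))
  have hp1 : (1 : ℝ) < p := one_lt_cast_prime
  have hp1' : (p : ℝ) - 1 ≠ 0 := by linarith
  have hp0 : (p : ℝ) ^ (sOf l + (j + 1)) ≠ 0 := by positivity
  rw [← Real.exp_log (show 0 < coeffSize l (p ^ (sOf l + (j + 1))) *
      (‖1 - l‖ ^ (-(1 / (p : ℝ))) * rTilde l) ^ p ^ (sOf l + (j + 1)) by positivity),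
    Real.log_mul (by positivity) (by positivity),
    Real.log_pow, log_radius hp2 hl hl₂, log_coeffSize_prime_pow hl hl₂ (by omega),
    coeffSlope_sOf_add hp2 hl hl₂]
  congr 1
  push_cast
  field_simp
  ring

/-- The linearization disk of a series with `|a₂| = 1` and `|a₂² - a₃| = 1`. -/
theorem isLinearizationDisk_of_norm_eq_one (hp3 : 3 ≤ p) (hl₁ : 1 / (p : ℝ) < ‖1 - l‖)
    (hl₂ : ‖1 - l‖ < 1) {f : PowerSeries ℂ_[p]} (hf : f ∈ classG l)
    (ha₂ : ‖PowerSeries.coeff 2 f‖ = 1)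
    (ha₃ : ‖PowerSeries.coeff 2 f ^ 2 - PowerSeries.coeff 3 f‖ = 1) :
    IsLinearizationDisk f (Metric.ball 0 (‖1 - l‖ ^ (-(1 / (p : ℝ))) * rTilde l)) := by
  have hp2 : p ≠ 2 := by omega
  have hl := hf.1.2
  have hr := radius_pos hp2 hl hl₂
  have hle := coeffSize_mul_radius_pow_le hp2 hl hl₁ hl₂
  have heq := coeffSize_mul_radius_pow_prime_pow hp2 hl hl₂
  have hmono := coeffSize_strictMono hl hp2 hl₁ hl₂
  set r := ‖1 - l‖ ^ (-(1 / (p : ℝ))) * rTilde l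
  have hcoeff : ∀ n, ‖PowerSeries.coeff (n + 1) (conjSeries f l)‖ = coeffSize l n := fun n => by
    rw [conjSeries, PowerSeries.coeff_mk, norm_recCoeff_eq hp3 hl₁ hl₂ hf ha₂ ha₃]
  refine isLinearizationDisk_ball hf hr ?_ ?_ ?_
  -- The case `n = 1` of the upper bound already gives `r ≤ 1`.
  · have h1 : 1 < coeffSize l 1 := hmono zero_lt_one
    have := hle 1
    rw [pow_one] at this
    exact (le_mul_of_one_le_left hr.le h1.le).trans this
  · intro k
    rcases k with _ | k
    · rw [conjSeries, PowerSeries.coeff_mk, recCoeff_zero]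
      simpa using hr.le
    · rw [hcoeff, pow_succ, ← mul_assoc]
      exact mul_le_of_le_one_left hr.le (hle k)
  · intro h
    -- The shift by one is due to `coeffSize l n` being the size in degree `n + 1`.
    have hsub : Tendsto (fun j : ℕ => p ^ (sOf l + (j + 1)) + 1) atTop atTop := by
      refine tendsto_atTop_mono (fun j => ?_) tendsto_id
      have : sOf l + (j + 1) < p ^ (sOf l + (j + 1)) := Nat.lt_pow_self hp.out.one_lt
      simp only [id]
      omega
    have h2 := h.comp hsub
    have hconst : (fun k => ‖PowerSeries.coeff k (conjSeries f l)‖ * r ^ k) ∘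
        (fun j : ℕ => p ^ (sOf l + (j + 1)) + 1) =
        fun _ => Real.exp (-(Real.log p / (p - 1))) * r := by
      funext j
      rw [Function.comp_apply, hcoeff, pow_succ, ← mul_assoc, heq]
    rw [hconst] at h2
    have := tendsto_nhds_unique h2 tendsto_const_nhds
    exact absurd this.symm (by positivity)

theorem coeff_quadP (l : ℂ_[p]) (n : ℕ) :
    PowerSeries.coeff n (quadP l) = (if n = 1 then l else 0) + if n = 2 then 1 else 0 := by
  rw [quadP, map_add, PowerSeries.coeff_C_mul, PowerSeries.coeff_X, PowerSeries.coeff_X_pow,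
    mul_ite, mul_one, mul_zero]

theorem quadP_mem_classG (hl : ‖l‖ = 1 ∧ ∀ n : ℕ, 1 ≤ n → l ^ n ≠ 1) : quadP l ∈ classG l := by
  refine ⟨hl, by simp [coeff_quadP], by simp [coeff_quadP], fun i hi => ?_⟩
  rw [coeff_quadP, if_neg (by omega), zero_add]
  split_ifs <;> simp

end Radius

theorem corollaryB (p : ℕ) [Fact p.Prime] (hp : 3 ≤ p) (l : ℂ_[p])
    (hl₁ : 1 / (p : ℝ) < ‖1 - l‖) (hl₂ : ‖1 - l‖ < 1)
    (f : PowerSeries ℂ_[p]) (hf : f ∈ classG l)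
    (ha₂ : ‖PowerSeries.coeff 2 f‖ = 1)
    (ha₃ : ‖PowerSeries.coeff 2 f ^ 2 - PowerSeries.coeff 3 f‖ = 1) :
    IsLinearizationDisk f (Metric.ball 0 (‖1 - l‖ ^ (-(1 / (p : ℝ))) * rTilde l)) ∧
    IsLinearizationDisk (quadP l) (Metric.ball 0 (‖1 - l‖ ^ (-(1 / (p : ℝ))) * rTilde l)) :=
  ⟨isLinearizationDisk_of_norm_eq_one hp hl₁ hl₂ hf ha₂ ha₃,
    isLinearizationDisk_of_norm_eq_one hp hl₁ hl₂ (quadP_mem_classG hf.1)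
      (by simp [coeff_quadP]) (by simp [coeff_quadP])⟩
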